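/- **Setting.** Let $\mathbb T=\mathbb R/\mathbb Z$, $e_j(x)=e^{2\pi i jx}$ for $j\in\mathbb Z$, and let $\xi$ be a space-time white noise on $[0,\infty)\times\mathbb T$ on a probability space $(\Omega,\mathcal F,\mathbb P)$: to every bounded Borel set $A\subset[0,\infty)\times\mathbb T$ it assigns $\xi(A)\in L^2(\Omega)$, finite families $(\xi(A_1),\dots,\xi(A_k))$ being centred Gaussian vectors with $\mathbb E[\xi(A)\xi(B)]=|A\cap B|$. Integrals $\int\!\!\int g\,d\xi$ of deterministic $g\in L^2$ are the $L^2(\Omega)$-limits of the integrals of step functions. Let $p_t(x,y)=\sum_{j\in\mathbb Z}e^{-4\pi^2j^2t}e_j(x-y)$, and let $O$ be the solution of the linear stochastic heat equation with zero initial value, i.e. the real random field that is almost surely continuous on $[0,\infty)\times\mathbb T$ and satisfies, for each $(t,x)$, almost surely $$O_t(x)=\int_0^t\!\int_{\mathbb T}p_{t-s}(x,y)\,\xi(dy,ds).$$ For $n\ge1$ and $c\in(0,1/8]$ let $h=c(2n)^{-2}$, $\Pi_n=\{0,\frac1{2n},\dots,\frac{2n-1}{2n}\}\subset\mathbb T$,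 $\kappa_n(t)=\lfloor t/h\rfloor h$, $\rho_n(y)=\lfloor 2ny\rfloor/(2n)$ for $y\in[0,1)$, $\lambda^n_j=-16n^2\sin^2(j\pi/(2n))$, $p^n_t(x,y)=\sum_{j=-n}^{n-1}(1+h\lambda^n_j)^{t/h}e_j(x-y)$, and for $t\ge0$, $x\in\Pi_n$ let, almost surely, $$O^n_t(x)=\int_0^t\!\int_{\mathbb T}p^n_{\kappa_n(t-s)}(x,\rho_n(y))\,\xi(dy,ds).$$ Let $\delta f=f|_{\Pi_n}$, $\langle f,\delta e_k\rangle_n=\frac1{2n}\sum_{x\in\Pi_n}f(x)\overline{e_k(x)}$ and $\iota f=\sum_{j=-n}^{n-1}\langle f,\delta e_j\rangle_n\,e_j$ for $f:\Pi_n\to\mathbb C$. Fix $\varepsilon_0\in(0,1/10)$ and a smooth even $\phi^0:\mathbb R\to[0,1]$ with $\phi^0=1$ on $[-1+\varepsilon_0,1-\varepsilon_0]$ and support in $[-1,1]$. Put $\rho_0=(3-2\varepsilon_0)/2$, $\phi^0_\rho(x)=\phi^0((\rho_0/\rho)x)$ for $\rho\in[1,2]$, and $\phi^j_\rho(x)=\phi^0_\rho(2^{-j}x)-\phi^0_\rho(2^{-j+1}x)$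 for $j\ge1$. Let $\bar\rho_n=n2^{-\lfloor\log_2n\rfloor}\in[1,2]$, and define $$\|f\|_{B^\alpha_{\infty,\infty}(\mathbb T)}=\sup_{j\ge0}2^{\alpha j}\Big\|\sum_{k\in\mathbb Z}\phi^j_1(k)\langle f,e_k\rangle e_k\Big\|_{L^\infty(\mathbb T)},$$ $$\|f\|_{B^\alpha_{\infty,\infty}(\Pi_n)}=\sup_{j\ge0}2^{\alpha j}\max_{x\in\Pi_n}\Big|\sum_{k=-n}^{n-1}\phi^j_{\bar\rho_n}(k)\langle f,\delta e_k\rangle_n e_k(x)\Big|.$$ **Lemma.** Let $\alpha\in\mathbb R$ and $q\in[1,\infty)$. There is a constant $N$, depending only on $\alpha$, $q$ (and on the fixed $\varepsilon_0$, $\phi^0$), such that for all $c\in(0,1/8]$, all integers $n\ge1$ and all $t\in[0,1]$: * if $\alpha\in(-1/2,1/2)$, then $$\mathbb E\|O_t-\iota O^n_t\|^q_{B^\alpha_{\infty,\infty}(\mathbb T)}\le N n^{-q(1/2-\alpha-1/q)}\quad\text{and}\quad \mathbb E\|\delta O_t-O^n_t\|^q_{B^\alpha_{\infty,\infty}(\Pi_n)}\le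 N n^{-q(1/2-\alpha-1/q)};$$ * if $\alpha<-1/2$, then $$\mathbb E\|O_t-\iota O^n_t\|^q_{B^\alpha_{\infty,\infty}(\mathbb T)}\le N n^{-q}\quad\text{and}\quad \mathbb E\|\delta O_t-O^n_t\|^q_{B^\alpha_{\infty,\infty}(\Pi_n)}\le N n^{-q}.$$ -/

import Mathlib

open MeasureTheory ProbabilityTheory Set

noncomputable section

namespace SpaceTimeNoise

/-! ### The torus, white noise and its Wiener integral.
The torus is `UnitAddCircle`, its characters `e_j(x) = exp(2πijx)` are `fourier j`. -/

/-- Bounded Borel subsets of `[0,∞) × 𝕋`. -/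
def IsBoundedBorel (A : Set (ℝ × UnitAddCircle)) : Prop :=
  MeasurableSet A ∧ ∃ M : ℝ, A ⊆ Icc 0 M ×ˢ univ

/-- Space-time white noise on `[0,∞) × 𝕋`: a family of square integrable random variables indexed
by the bounded Borel sets, whose finite subfamilies are centred jointly Gaussian vectors with
covariance `𝔼[ξ(A) ξ(B)] = |A ∩ B|`. Values of `ξ` at other sets are irrelevant. -/
structure IsWhiteNoise {Ω : Type*} [MeasurableSpace Ω] (P : Measure Ω)
    (ξ : Set (ℝ × UnitAddCircle) → Ω → ℝ) : Prop where
  memLp : ∀ A, IsBoundedBorel A → MemLp (ξ A) 2 P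
  gaussian : ∀ (k : ℕ) (A : Fin k → Set (ℝ × UnitAddCircle)), (∀ i, IsBoundedBorel (A i)) →
    HasGaussianLaw (fun ω i => ξ (A i) ω) P
  mean : ∀ A, IsBoundedBorel A → ∫ ω, ξ A ω ∂P = 0
  covariance : ∀ A B, IsBoundedBorel A → IsBoundedBorel B →
    ∫ ω, ξ A ω * ξ B ω ∂P = (volume (A ∩ B)).toReal

/-- `X` is (a version of) the stochastic integral `∫∫ g dξ` of the deterministic function
`g ∈ L²([0,∞) × 𝕋; ℂ)`: there are step functions `∑ aᵢ 1_{Aᵢ}` arbitrarily close to `g` in `L²`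
whose elementary integrals `∑ aᵢ ξ(Aᵢ)` are arbitrarily close to `X` in `L²(Ω)`. -/
def IsWienerIntegral {Ω : Type*} [MeasurableSpace Ω] (P : Measure Ω)
    (ξ : Set (ℝ × UnitAddCircle) → Ω → ℝ) (g : ℝ × UnitAddCircle → ℂ) (X : Ω → ℂ) : Prop :=
  MemLp g 2 (volume.restrict (Ici 0 ×ˢ univ)) ∧ MemLp X 2 P ∧
  ∀ ε : ENNReal, 0 < ε → ∃ (m : ℕ) (a : Fin m → ℂ) (A : Fin m → Set (ℝ × UnitAddCircle)),
    (∀ i, IsBoundedBorel (A i)) ∧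
    eLpNorm (fun z => g z - ∑ i, (A i).indicator (fun _ => a i) z) 2
      (volume.restrict (Ici 0 ×ˢ univ)) ≤ ε ∧
    eLpNorm (fun ω => X ω - ∑ i, a i * (ξ (A i) ω : ℂ)) 2 P ≤ ε

/-! ### Heat kernels and the linear solutions -/

/-- The heat kernel `p_t(x,y) = ∑_{j ∈ ℤ} exp(-4π²j²t) e_j(x-y)`. -/
def heatKernel (t : ℝ) (x y : UnitAddCircle) : ℂ :=
  ∑' j : ℤ, (Real.exp (-4 * Real.pi ^ 2 * (j : ℝ) ^ 2 * t) : ℂ) * fourier j (x - y)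

/-- `O` is the solution of the linear stochastic heat equation with zero initial value: a
random field, almost surely continuous on `[0,∞) × 𝕋`, with
`O_t(x) = ∫_0^t ∫_𝕋 p_{t-s}(x,y) ξ(dy,ds)` almost surely, for each `(t,x)`. -/
structure IsLinearSolution {Ω : Type*} [MeasurableSpace Ω] (P : Measure Ω)
    (ξ : Set (ℝ × UnitAddCircle) → Ω → ℝ) (O : ℝ → UnitAddCircle → Ω → ℝ) : Prop where
  continuous : ∀ᵐ ω ∂P, ContinuousOn (fun z : ℝ × UnitAddCircle => O z.1 z.2 ω) (Ici 0 ×ˢ univ)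
  integral : ∀ t, 0 ≤ t → ∀ x, IsWienerIntegral P ξ
    ((Ioo 0 t ×ˢ univ).indicator fun z => heatKernel (t - z.1) x z.2) (fun ω => (O t x ω : ℂ))

/-- The time step `h = c (2n)⁻²`. -/
def timeStep (c : ℝ) (n : ℕ) : ℝ := c / (2 * n) ^ 2

/-- The `i`-th point `i/(2n)` of the space grid `Π_n ⊂ 𝕋`; functions on `Π_n` are functions on
`Fin (2 * n)`. -/
def gridPoint (n : ℕ) (i : Fin (2 * n)) : UnitAddCircle := (((i : ℕ) : ℝ) / (2 * n) : ℝ)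

/-- `κ_n(t) = ⌊t/h⌋ h`. -/
def kappa (c : ℝ) (n : ℕ) (t : ℝ) : ℝ := ⌊t / timeStep c n⌋ * timeStep c n

/-- `ρ_n(y) = ⌊2ny⌋ / (2n)`, where `y ∈ 𝕋` is represented in `[0,1)`. -/
def rho (n : ℕ) (y : UnitAddCircle) : UnitAddCircle :=
  ((⌊2 * n * (AddCircle.equivIco (1 : ℝ) 0 y : ℝ)⌋ : ℝ) / (2 * n) : ℝ)

/-- The eigenvalue `λ_j^n = -16 n² sin²(jπ/(2n))` of the discrete Laplacian. -/
def discreteEigenvalue (n : ℕ) (j : ℤ) : ℝ :=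
  -16 * (n : ℝ) ^ 2 * Real.sin (j * Real.pi / (2 * n)) ^ 2

/-- The discrete heat kernel `p^n_t(x,y) = ∑_{j=-n}^{n-1} (1 + h λ_j^n)^{t/h} e_j(x-y)`. -/
def discreteHeatKernel (c : ℝ) (n : ℕ) (t : ℝ) (x y : UnitAddCircle) : ℂ :=
  ∑ j ∈ Finset.Ico (-(n : ℤ)) n,
    (((1 + timeStep c n * discreteEigenvalue n j) ^ (t / timeStep c n) : ℝ) : ℂ) *
      fourier j (x - y)

/-- `On` is the linear part of the finite difference scheme:
`O^n_t(x) = ∫_0^t ∫_𝕋 p^n_{κ_n(t-s)}(x, ρ_n(y)) ξ(dy,ds)` almost surely, for `t ≥ 0`, `x ∈ Π_n`. -/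
def IsDiscreteLinearSolution {Ω : Type*} [MeasurableSpace Ω] (P : Measure Ω)
    (ξ : Set (ℝ × UnitAddCircle) → Ω → ℝ) (c : ℝ) (n : ℕ)
    (On : ℝ → Fin (2 * n) → Ω → ℝ) : Prop :=
  ∀ t, 0 ≤ t → ∀ i, IsWienerIntegral P ξ
    ((Ioo 0 t ×ˢ univ).indicator
      fun z => discreteHeatKernel c n (kappa c n (t - z.1)) (gridPoint n i) (rho n z.2))
    (fun ω => (On t i ω : ℂ))

/-! ### Restriction, extension and Besov norms -/

/-- The restriction `δ` of a function on `𝕋` to the grid. -/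
def restrictGrid {E : Type*} (n : ℕ) (f : UnitAddCircle → E) : Fin (2 * n) → E :=
  fun i => f (gridPoint n i)

/-- The discrete Fourier coefficient
`⟨f, δe_k⟩_n = (2n)⁻¹ ∑_{x ∈ Π_n} f(x) conj(e_k(x))`. -/
def discreteFourierCoeff (n : ℕ) (f : Fin (2 * n) → ℂ) (k : ℤ) : ℂ :=
  1 / (2 * n) * ∑ i, f i * starRingEnd ℂ (fourier k (gridPoint n i))

/-- The extension `ι f = ∑_{j=-n}^{n-1} ⟨f, δe_j⟩_n e_j`. -/
def extendGrid (n : ℕ) (f : Fin (2 * n) → ℂ) : UnitAddCircle → ℂ :=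
  fun x => ∑ j ∈ Finset.Ico (-(n : ℤ)) n, discreteFourierCoeff n f j * fourier j x

/-- Admissible bump functions `φ⁰`. -/
structure IsBump (ε₀ : ℝ) (φ : ℝ → ℝ) : Prop where
  smooth : ContDiff ℝ (⊤ : ℕ∞) φ
  even : ∀ x, φ (-x) = φ x
  mem_Icc : ∀ x, φ x ∈ Icc (0 : ℝ) 1
  eq_one : ∀ x, |x| ≤ 1 - ε₀ → φ x = 1
  support : tsupport φ ⊆ Icc (-1) 1

/-- The cutoff `φ⁰_ρ(x) = φ⁰((ρ₀/ρ) x)` with `ρ₀ = (3 - 2ε₀)/2`. -/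
def cutoffZero (ε₀ : ℝ) (φ : ℝ → ℝ) (ρ x : ℝ) : ℝ := φ ((3 - 2 * ε₀) / 2 / ρ * x)

/-- The cutoffs `φ^j_ρ`: `φ^j_ρ(x) = φ⁰_ρ(2^{-j}x) - φ⁰_ρ(2^{-j+1}x)` for `j ≥ 1`. -/
def cutoff (ε₀ : ℝ) (φ : ℝ → ℝ) (ρ : ℝ) : ℕ → ℝ → ℝ
  | 0, x => cutoffZero ε₀ φ ρ x
  | j + 1, x => cutoffZero ε₀ φ ρ (x / 2 ^ (j + 1)) - cutoffZero ε₀ φ ρ (x / 2 ^ j)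

/-- The Littlewood-Paley block `f^{[j]} = ∑_{k ∈ ℤ} φ^j_1(k) ⟨f, e_k⟩ e_k`
(only finitely many terms are nonzero). -/
def block (ε₀ : ℝ) (φ : ℝ → ℝ) (j : ℕ) (f : UnitAddCircle → ℂ) : UnitAddCircle → ℂ :=
  fun x => ∑' k : ℤ, (cutoff ε₀ φ 1 j k : ℂ) * fourierCoeff f k * fourier k x

/-- The norm of `B^α_{∞,∞}(𝕋)`: `sup_j 2^{αj} ‖f^{[j]}‖_{L^∞(𝕋)}`. -/
def besovNorm (ε₀ : ℝ) (φ : ℝ → ℝ) (α : ℝ) (f : UnitAddCircle → ℂ) : ENNReal :=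
  ⨆ j : ℕ, ENNReal.ofReal ((2 : ℝ) ^ (α * j)) * eLpNorm (block ε₀ φ j f) ⊤ volume

/-- `ρ_n = n 2^{-J_n}` with `J_n = ⌊log₂ n⌋`. -/
def gridRatio (n : ℕ) : ℝ := n / 2 ^ Nat.log 2 n

/-- The discrete block `f^{[j],n} = ∑_{k=-n}^{n-1} φ^j_{ρ_n}(k) ⟨f, δe_k⟩_n δe_k`. -/
def discreteBlock (ε₀ : ℝ) (φ : ℝ → ℝ) (n j : ℕ) (f : Fin (2 * n) → ℂ) : Fin (2 * n) → ℂ :=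
  fun i => ∑ k ∈ Finset.Ico (-(n : ℤ)) n,
    (cutoff ε₀ φ (gridRatio n) j k : ℂ) * discreteFourierCoeff n f k * fourier k (gridPoint n i)

/-- The norm of `B^α_{∞,∞}(Π_n)`: `sup_j 2^{αj} max_{x ∈ Π_n} |f^{[j],n}(x)|`. -/
def discreteBesovNorm (ε₀ : ℝ) (φ : ℝ → ℝ) (α : ℝ) (n : ℕ) (f : Fin (2 * n) → ℂ) : ENNReal :=
  ⨆ j : ℕ, ENNReal.ofReal ((2 : ℝ) ^ (α * j)) * ⨆ i, ‖discreteBlock ε₀ φ n j f i‖ₑ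

/-- `𝔼 ‖O_t - ι O^n_t‖^q` in `B^α_{∞,∞}(𝕋)`. -/
def continuousError {Ω : Type*} [MeasurableSpace Ω] (P : Measure Ω) (ε₀ : ℝ) (φ : ℝ → ℝ)
    (α q : ℝ) (n : ℕ) (Ot : UnitAddCircle → Ω → ℝ) (Ont : Fin (2 * n) → Ω → ℝ) : ENNReal :=
  ∫⁻ ω, besovNorm ε₀ φ α
    (fun x => (Ot x ω : ℂ) - extendGrid n (fun i => (Ont i ω : ℂ)) x) ^ q ∂P

/-- `𝔼 ‖δ O_t - O^n_t‖^q` in `B^α_{∞,∞}(Π_n)`. -/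
def discreteError {Ω : Type*} [MeasurableSpace Ω] (P : Measure Ω) (ε₀ : ℝ) (φ : ℝ → ℝ)
    (α q : ℝ) (n : ℕ) (Ot : UnitAddCircle → Ω → ℝ) (Ont : Fin (2 * n) → Ω → ℝ) : ENNReal :=
  ∫⁻ ω, discreteBesovNorm ε₀ φ α n
    (fun i => restrictGrid n (fun x => (Ot x ω : ℂ)) i - (Ont i ω : ℂ)) ^ q ∂P

end SpaceTimeNoise

end

open MeasureTheory ProbabilityTheory Set Filter Topology

noncomputable section

namespace SpaceTimeNoise

/-! Every Littlewood-Paley block of the error is a finite linear combination of Fourier modes, and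
each such combination is a single Wiener integral. Gaussianity therefore reduces its moments of
every order to the `L²` norm of a deterministic kernel (`IsWienerIntegral.eLpNorm_le`).

That kernel is almost diagonal in Fourier space. The multiplier error at frequency `k` is at most a
constant times `(k²/n²) exp(-8k²τ)`, with one-step consistency errors summed by telescoping
(`abs_heatFactor_sub_schemeFactor_le`). Freezing the noise variable at the left end of its cell
costs a factor `|k|/n`, and the cell errors of distinct frequencies are orthogonal by translation
symmetry of the grid. Aliased frequencies are damped by the heat semigroup. Integration in time
gains `1/l²` at frequency `l`, so the error of the combination with coefficients `b` has variance at
most a constant times `∑ |b_k|² / max(n,|k|)²` (`eLpNorm_modes_le`).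

The two errors are treated together by sampling `O` on a grid `Π_M` with `M ≥ n`. The grid error is
the case `M = n`. The error on the torus is the limit `M → ∞`: almost sure continuity makes the
discrete Fourier coefficients of `O_t` converge to the true ones, so no stochastic Fubini theorem is
needed.

On the `j`-th block, `max(n,|k|)` dominates a constant multiple of `n^θ 2^{j(1-θ)}` for each `θ ∈
[0,1]`, so the block has pointwise moments of order `n^{-θ} 2^{j(θ-1/2)}`. The block is a
trigonometric polynomial of degree of order `2^j`, so the `p`-th power of its maximum is at most the
sum of its `p`-th powers over about `p 2^j` points (`norm_pow_le_sum_gridPoint`). Summing over `j`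
converges when `p(α+θ-1/2)+2 ≤ 0`, and Jensen's inequality passes from `p` to `q`. A large `p`
allows `θ = 1/2-α-2/p ≥ 1/2-α-1/q` when `|α| < 1/2`, and the saturated value `θ = 1` when `α <
-1/2`. -/

/-- The measure space `[0,∞) × 𝕋` on which the white noise lives. -/
abbrev baseMeasure : Measure (ℝ × UnitAddCircle) := volume.restrict (Ici 0 ×ˢ univ)

/-! ### Gaussian moments of Wiener integrals -/

section WienerIntegral

variable {Ω : Type*} [MeasurableSpace Ω] {P : Measure Ω}
  {ξ : Set (ℝ × UnitAddCircle) → Ω → ℝ}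

lemma IsBoundedBorel.subset_base {A : Set (ℝ × UnitAddCircle)} (hA : IsBoundedBorel A) :
    A ⊆ Ici 0 ×ˢ univ := by
  obtain ⟨-, M, hM⟩ := hA
  exact hM.trans (prod_mono Icc_subset_Ici_self subset_rfl)

lemma IsBoundedBorel.volume_lt_top {A : Set (ℝ × UnitAddCircle)} (hA : IsBoundedBorel A) :
    volume A < ⊤ := by
  obtain ⟨-, M, hM⟩ := hA
  refine (measure_mono hM).trans_lt ?_
  rw [Measure.volume_eq_prod, Measure.prod_prod]
  simp

lemma IsBoundedBorel.inter {A B : Set (ℝ × UnitAddCircle)} (hA : IsBoundedBorel A)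
    (hB : IsBoundedBorel B) : IsBoundedBorel (A ∩ B) :=
  ⟨hA.1.inter hB.1, hA.2.imp fun _ h => inter_subset_left.trans h⟩

lemma IsBoundedBorel.memLp_indicator {A : Set (ℝ × UnitAddCircle)} (hA : IsBoundedBorel A)
    {E : Type*} [NormedAddCommGroup E] (a : E) (p : ENNReal) :
    MemLp (A.indicator fun _ => a) p baseMeasure :=
  memLp_indicator_const p hA.1 a
    (Or.inr ((Measure.restrict_apply_le _ _).trans_lt hA.volume_lt_top).ne)

lemma IsBoundedBorel.integral_indicator_mul {A B : Set (ℝ × UnitAddCircle)}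
    (hA : IsBoundedBorel A) (hB : IsBoundedBorel B) (a b : ℝ) :
    ∫ z, A.indicator (fun _ => a) z * B.indicator (fun _ => b) z ∂baseMeasure =
      a * b * (volume (A ∩ B)).toReal := by
  have h : (fun z => A.indicator (fun _ => a) z * B.indicator (fun _ => b) z) =
      (A ∩ B).indicator fun _ => a * b := by
    ext z
    by_cases h1 : z ∈ A <;> by_cases h2 : z ∈ B <;> simp [h1, h2]
  rw [h, integral_indicator_const _ (hA.inter hB).1, smul_eq_mul, mul_comm, Measure.real,
    Measure.restrict_apply (hA.inter hB).1,
    inter_eq_left.2 (inter_subset_left.trans hA.subset_base)]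

/-- A linear combination of values of the white noise is a centred Gaussian variable whose
variance is the squared `L²` norm of the corresponding step function. -/
lemma IsWhiteNoise.map_sum [IsProbabilityMeasure P] (hξ : IsWhiteNoise P ξ) {m : ℕ}
    (b : Fin m → ℝ) {A : Fin m → Set (ℝ × UnitAddCircle)} (hA : ∀ i, IsBoundedBorel (A i)) :
    P.map (fun ω => ∑ i, b i * ξ (A i) ω) = gaussianReal 0
      (∫ z, (∑ i, (A i).indicator (fun _ => b i) z) ^ 2 ∂baseMeasure).toNNReal := by
  have hL : HasGaussianLaw (fun ω => ∑ i, b i * ξ (A i) ω) P := by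
    have := (hξ.gaussian m A hA).map_fun (∑ i, b i • ContinuousLinearMap.proj (R := ℝ) i)
    exact this.congr (ae_of_all _ fun ω => by simp)
  have hm : ∀ i, MemLp (ξ (A i)) 2 P := fun i => hξ.memLp _ (hA i)
  have h0 : ∫ ω, ∑ i, b i * ξ (A i) ω ∂P = 0 := by
    rw [integral_finsetSum _ fun i _ => ((hm i).integrable one_le_two).const_mul _]
    simp [integral_const_mul, hξ.mean _ (hA _)]
  have h2 : Var[fun ω => ∑ i, b i * ξ (A i) ω; P] =
      ∫ z, (∑ i, (A i).indicator (fun _ => b i) z) ^ 2 ∂baseMeasure := by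
    rw [variance_eq_integral hL.aemeasurable, h0]
    simp only [sub_zero, sq, Finset.sum_mul_sum]
    rw [integral_finsetSum _ fun i _ => ?_, integral_finsetSum _ fun i _ => ?_]
    · refine Finset.sum_congr rfl fun i _ => ?_
      rw [integral_finsetSum _ fun j _ => ?_, integral_finsetSum _ fun j _ => ?_]
      · refine Finset.sum_congr rfl fun j _ => ?_
        rw [(hA i).integral_indicator_mul (hA j), ← hξ.covariance _ _ (hA i) (hA j),
          ← integral_const_mul]
        congr 1 with ω
        ring
      · exact ((hA i).memLp_indicator (b i) 2).integrable_mul ((hA j).memLp_indicator (b j) 2)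
      · exact ((hm i).const_mul (b i)).integrable_mul ((hm j).const_mul (b j))
    · exact integrable_finsetSum _ fun j _ =>
        ((hA i).memLp_indicator (b i) 2).integrable_mul ((hA j).memLp_indicator (b j) 2)
    · exact integrable_finsetSum _ fun j _ =>
        ((hm i).const_mul (b i)).integrable_mul ((hm j).const_mul (b j))
  rw [hL.map_eq_gaussianReal, h0, h2]

/-- The `L^p` norm of a standard real Gaussian variable. -/
def gaussianMoment (p : ENNReal) : ENNReal := eLpNorm id p (gaussianReal 0 1)

lemma gaussianMoment_ne_top {p : ENNReal} (hp : p ≠ ⊤) : gaussianMoment p ≠ ⊤ :=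
  (memLp_id_gaussianReal' p hp).eLpNorm_ne_top

lemma eLpNorm_of_map_eq_gaussianReal {Z : Ω → ℝ} (hZ : AEMeasurable Z P) {v : ℝ}
    (h : P.map Z = gaussianReal 0 v.toNNReal) (p : ENNReal) :
    eLpNorm Z p P = ENNReal.ofReal (√v) * gaussianMoment p := by
  have h1 : gaussianReal 0 v.toNNReal = (gaussianReal 0 1).map (√v * ·) := by
    rw [gaussianReal_map_const_mul]
    congr 1
    · simp
    · ext
      simp [Real.sq_sqrt']
  have h2 : eLpNorm Z p P = eLpNorm id p (P.map Z) :=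
    (eLpNorm_map_measure aestronglyMeasurable_id hZ).symm
  rw [h2, h, h1, eLpNorm_map_measure aestronglyMeasurable_id (by fun_prop)]
  have h3 : (id ∘ fun x : ℝ => √v * x) = √v • id := rfl
  rw [h3, eLpNorm_const_smul, gaussianMoment, ← ofReal_norm,
    Real.norm_of_nonneg (Real.sqrt_nonneg v)]

lemma eLpNorm_two_eq_sqrt {α : Type*} [MeasurableSpace α] {μ : Measure α} {f : α → ℝ}
    (hf : MemLp f 2 μ) : eLpNorm f 2 μ = ENNReal.ofReal (√(∫ z, f z ^ 2 ∂μ)) := by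
  rw [hf.eLpNorm_eq_integral_rpow_norm (by simp) (by simp)]
  simp [Real.sqrt_eq_rpow]

lemma IsWhiteNoise.eLpNorm_sum_real [IsProbabilityMeasure P] (hξ : IsWhiteNoise P ξ) {m : ℕ}
    (b : Fin m → ℝ) {A : Fin m → Set (ℝ × UnitAddCircle)} (hA : ∀ i, IsBoundedBorel (A i))
    (p : ENNReal) :
    eLpNorm (fun ω => ∑ i, b i * ξ (A i) ω) p P =
      eLpNorm (fun z => ∑ i, (A i).indicator (fun _ => b i) z) 2 baseMeasure *
        gaussianMoment p := by
  have hm : ∀ i, MemLp (ξ (A i)) 2 P := fun i => hξ.memLp _ (hA i)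
  have hZ : AEMeasurable (fun ω => ∑ i, b i * ξ (A i) ω) P :=
    Finset.aemeasurable_fun_sum _ fun i _ =>
      (hm i).aestronglyMeasurable.aemeasurable.const_mul _
  rw [eLpNorm_of_map_eq_gaussianReal hZ (hξ.map_sum b hA), eLpNorm_two_eq_sqrt]
  exact memLp_finsetSum _ fun i _ => (hA i).memLp_indicator (b i) 2

/-- The real and imaginary parts are each Gaussian with standard deviation at most the complex `L²`
norm; the triangle inequality gives the factor 2, whatever their correlation. -/
lemma IsWhiteNoise.eLpNorm_sum_le [IsProbabilityMeasure P] (hξ : IsWhiteNoise P ξ) {m : ℕ}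
    (a : Fin m → ℂ) {A : Fin m → Set (ℝ × UnitAddCircle)} (hA : ∀ i, IsBoundedBorel (A i))
    {p : ENNReal} (hp : 1 ≤ p) :
    eLpNorm (fun ω => ∑ i, a i * (ξ (A i) ω : ℂ)) p P ≤ 2 * gaussianMoment p *
      eLpNorm (fun z => ∑ i, (A i).indicator (fun _ => a i) z) 2 baseMeasure := by
  have hm : ∀ i, AEStronglyMeasurable (ξ (A i)) P := fun i =>
    (hξ.memLp _ (hA i)).aestronglyMeasurable
  have hsplit : (fun ω => ∑ i, a i * (ξ (A i) ω : ℂ)) =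
      (fun ω => ((∑ i, (a i).re * ξ (A i) ω : ℝ) : ℂ)) +
        fun ω => Complex.I * ((∑ i, (a i).im * ξ (A i) ω : ℝ) : ℂ) := by
    ext ω
    simp only [Pi.add_apply, Complex.ofReal_sum, Complex.ofReal_mul, Finset.mul_sum,
      ← Finset.sum_add_distrib]
    refine Finset.sum_congr rfl fun i _ => ?_
    conv_lhs => rw [← Complex.re_add_im (a i)]
    ring
  have hreal : ∀ b : Fin m → ℝ,
      AEStronglyMeasurable (fun ω => ((∑ i, b i * ξ (A i) ω : ℝ) : ℂ)) P := fun b =>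
    Complex.continuous_ofReal.comp_aestronglyMeasurable
      (Finset.aestronglyMeasurable_fun_sum _ fun i _ => (hm i).const_mul _)
  have hre : eLpNorm (fun ω => ((∑ i, (a i).re * ξ (A i) ω : ℝ) : ℂ)) p P ≤
      eLpNorm (fun z => ∑ i, (A i).indicator (fun _ => a i) z) 2 baseMeasure *
        gaussianMoment p := by
    rw [eLpNorm_congr_norm_ae (g := fun ω => ∑ i, (a i).re * ξ (A i) ω)
      (ae_of_all _ fun ω => by simp only [Complex.norm_real]), hξ.eLpNorm_sum_real _ hA]
    gcongr
    refine eLpNorm_mono fun z => ?_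
    refine le_trans (le_of_eq ?_) (Complex.abs_re_le_norm _)
    rw [Real.norm_eq_abs, Complex.re_sum]
    congr 2 with i
    by_cases hz : z ∈ A i <;> simp [hz]
  have him : eLpNorm (fun ω => Complex.I * ((∑ i, (a i).im * ξ (A i) ω : ℝ) : ℂ)) p P ≤
      eLpNorm (fun z => ∑ i, (A i).indicator (fun _ => a i) z) 2 baseMeasure *
        gaussianMoment p := by
    rw [eLpNorm_congr_norm_ae (g := fun ω => ∑ i, (a i).im * ξ (A i) ω)
      (ae_of_all _ fun ω => by simp only [Complex.norm_mul, Complex.norm_I, one_mul,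
        Complex.norm_real]), hξ.eLpNorm_sum_real _ hA]
    gcongr
    refine eLpNorm_mono fun z => ?_
    refine le_trans (le_of_eq ?_) (Complex.abs_im_le_norm _)
    rw [Real.norm_eq_abs, Complex.im_sum]
    congr 2 with i
    by_cases hz : z ∈ A i <;> simp [hz]
  rw [hsplit]
  refine (eLpNorm_add_le (hreal _) ((hreal _).const_mul _) hp).trans ?_
  refine (add_le_add hre him).trans (le_of_eq ?_)
  ring

lemma IsWienerIntegral.zero : IsWienerIntegral P ξ (fun _ => 0) (fun _ => 0) :=
  ⟨MemLp.zero', MemLp.zero', fun ε _ => ⟨0, ![], ![], by simp⟩⟩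

/-- Concatenating two approximating step functions keeps the approximation of the integrand and of
the random variable simultaneous, which is what the definition asks for. -/
lemma IsWienerIntegral.add {g₁ g₂ : ℝ × UnitAddCircle → ℂ} {X₁ X₂ : Ω → ℂ}
    (hξ : IsWhiteNoise P ξ)
    (h₁ : IsWienerIntegral P ξ g₁ X₁) (h₂ : IsWienerIntegral P ξ g₂ X₂) :
    IsWienerIntegral P ξ (fun z => g₁ z + g₂ z) (fun ω => X₁ ω + X₂ ω) := by
  refine ⟨h₁.1.add h₂.1, h₁.2.1.add h₂.2.1, fun ε hε => ?_⟩
  obtain ⟨m₁, a₁, A₁, hA₁, hg₁, hX₁⟩ := h₁.2.2 (ε / 2) (ENNReal.half_pos hε.ne')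
  obtain ⟨m₂, a₂, A₂, hA₂, hg₂, hX₂⟩ := h₂.2.2 (ε / 2) (ENNReal.half_pos hε.ne')
  have hm : ∀ (m : ℕ) (a : Fin m → ℂ) (A : Fin m → Set (ℝ × UnitAddCircle)),
      (∀ i, IsBoundedBorel (A i)) →
      AEStronglyMeasurable (fun ω => ∑ i, a i * (ξ (A i) ω : ℂ)) P := fun m a A hA =>
    Finset.aestronglyMeasurable_fun_sum _ fun i _ =>
      (Complex.continuous_ofReal.comp_aestronglyMeasurable
        (hξ.memLp _ (hA i)).aestronglyMeasurable).const_mul _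
  have hs : ∀ (m : ℕ) (a : Fin m → ℂ) (A : Fin m → Set (ℝ × UnitAddCircle)),
      (∀ i, IsBoundedBorel (A i)) → AEStronglyMeasurable
        (fun z => ∑ i, (A i).indicator (fun _ => a i) z) baseMeasure := fun m a A hA =>
    Finset.aestronglyMeasurable_fun_sum _ fun i _ =>
      ((hA i).memLp_indicator (a i) 2).aestronglyMeasurable
  refine ⟨m₁ + m₂, Fin.append a₁ a₂, Fin.append A₁ A₂, ?_, ?_, ?_⟩
  · intro i
    refine Fin.addCases (fun i => ?_) (fun i => ?_) i
    · simpa using hA₁ i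
    · simpa using hA₂ i
  · rw [← ENNReal.add_halves ε]
    refine le_trans (le_trans (le_of_eq ?_) (eLpNorm_add_le
      (h₁.1.aestronglyMeasurable.sub (hs m₁ a₁ A₁ hA₁))
      (h₂.1.aestronglyMeasurable.sub (hs m₂ a₂ A₂ hA₂)) one_le_two)) (add_le_add hg₁ hg₂)
    congr 1 with z
    simp only [Fin.sum_univ_add, Fin.append_left, Fin.append_right, Pi.add_apply, Pi.sub_apply]
    ring
  · rw [← ENNReal.add_halves ε]
    refine le_trans (le_trans (le_of_eq ?_) (eLpNorm_add_le
      (h₁.2.1.aestronglyMeasurable.sub (hm m₁ a₁ A₁ hA₁))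
      (h₂.2.1.aestronglyMeasurable.sub (hm m₂ a₂ A₂ hA₂)) one_le_two)) (add_le_add hX₁ hX₂)
    congr 1 with ω
    simp only [Fin.sum_univ_add, Fin.append_left, Fin.append_right, Pi.add_apply, Pi.sub_apply]
    ring

lemma IsWienerIntegral.const_mul {g : ℝ × UnitAddCircle → ℂ} {X : Ω → ℂ}
    (h : IsWienerIntegral P ξ g X) (c : ℂ) :
    IsWienerIntegral P ξ (fun z => c * g z) (fun ω => c * X ω) := by
  refine ⟨h.1.const_mul c, h.2.1.const_mul c, fun ε hε => ?_⟩
  -- The `+ 1` covers `c = 0`.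
  obtain ⟨m, a, A, hA, hg, hX⟩ := h.2.2 (ε / (‖c‖ₑ + 1))
    (ENNReal.div_pos hε.ne' (by simp))
  have hle : ‖c‖ₑ * (ε / (‖c‖ₑ + 1)) ≤ ε := by
    calc ‖c‖ₑ * (ε / (‖c‖ₑ + 1)) ≤ (‖c‖ₑ + 1) * (ε / (‖c‖ₑ + 1)) := by gcongr; exact le_self_add
      _ ≤ ε := ENNReal.mul_div_le
  refine ⟨m, fun i => c * a i, A, hA, ?_, ?_⟩
  · refine le_trans (le_of_eq ?_) (le_trans (mul_le_mul_right hg ‖c‖ₑ) hle)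
    rw [← eLpNorm_const_smul]
    congr 1 with z
    simp only [Pi.smul_apply, smul_eq_mul, mul_sub, Finset.mul_sum]
    congr 2 with i
    by_cases hz : z ∈ A i <;> simp [hz]
  · refine le_trans (le_of_eq ?_) (le_trans (mul_le_mul_right hX ‖c‖ₑ) hle)
    rw [← eLpNorm_const_smul]
    congr 1 with ω
    simp [mul_sub, Finset.mul_sum, mul_assoc]

lemma IsWienerIntegral.sum {ι : Type*} {g : ι → ℝ × UnitAddCircle → ℂ} {X : ι → Ω → ℂ}
    (hξ : IsWhiteNoise P ξ) (s : Finset ι) (h : ∀ i ∈ s, IsWienerIntegral P ξ (g i) (X i)) :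
    IsWienerIntegral P ξ (fun z => ∑ i ∈ s, g i z) (fun ω => ∑ i ∈ s, X i ω) := by
  classical
  induction s using Finset.induction_on with
  | empty => simpa using IsWienerIntegral.zero
  | insert i s hi ih =>
    simp only [Finset.sum_insert hi]
    exact (h i (by simp)).add hξ (ih fun j hj => h j (by simp [hj]))

/-- Hypercontractivity: the moments of a Wiener integral are controlled by the `L²` norm of the
integrand. -/
theorem IsWienerIntegral.eLpNorm_le [IsProbabilityMeasure P] {g : ℝ × UnitAddCircle → ℂ}
    {X : Ω → ℂ} (hξ : IsWhiteNoise P ξ) (h : IsWienerIntegral P ξ g X) {p : ENNReal}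
    (hp : 1 ≤ p) (hp' : p ≠ ⊤) :
    eLpNorm X p P ≤ 2 * gaussianMoment p * eLpNorm g 2 baseMeasure := by
  have hpos : ∀ n : ℕ, (0 : ENNReal) < ((n : ENNReal) + 1)⁻¹ := fun n => by simp
  choose m a A hA hg hX using fun n : ℕ => h.2.2 _ (hpos n)
  have h0 : Tendsto (fun n : ℕ => ((n : ENNReal) + 1)⁻¹) atTop (𝓝 0) := by
    have := (tendsto_add_atTop_iff_nat 1).2 ENNReal.tendsto_inv_nat_nhds_zero
    simpa using this
  set Y : ℕ → Ω → ℂ := fun n ω => ∑ i, a n i * (ξ (A n i) ω : ℂ) with hY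
  have hYm : ∀ n, AEStronglyMeasurable (Y n) P := fun n =>
    Finset.aestronglyMeasurable_fun_sum _ fun i _ =>
      (Complex.continuous_ofReal.comp_aestronglyMeasurable
        (hξ.memLp _ (hA n i)).aestronglyMeasurable).const_mul _
  have hlim : Tendsto (fun n => eLpNorm (Y n - X) 2 P) atTop (𝓝 0) :=
    tendsto_of_tendsto_of_tendsto_of_le_of_le tendsto_const_nhds h0 (fun _ => zero_le)
      fun n => by
        rw [eLpNorm_sub_comm]
        exact hX n
  -- Convergence is known only in `L²`, but an almost surely convergent subsequence and Fatou's
  -- lemma carry over the `L^p` bound for every finite `p`.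
  obtain ⟨ns, hns, hae⟩ := (tendstoInMeasure_of_tendsto_eLpNorm (by simp) hYm
    h.2.1.aestronglyMeasurable hlim).exists_seq_tendsto_ae
  refine (Lp.eLpNorm_lim_le_liminf_eLpNorm (fun n => hYm (ns n)) X hae).trans ?_
  have hb : ∀ n, eLpNorm (Y (ns n)) p P ≤
      2 * gaussianMoment p * (eLpNorm g 2 baseMeasure + ((ns n : ENNReal) + 1)⁻¹) := by
    intro n
    refine (hξ.eLpNorm_sum_le (a (ns n)) (hA (ns n)) hp).trans ?_
    gcongr
    refine le_trans ?_ (add_le_add le_rfl (hg (ns n)))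
    have hs : MemLp (fun z => ∑ i, (A (ns n) i).indicator (fun _ => a (ns n) i) z) 2
        baseMeasure := memLp_finsetSum _ fun i _ => (hA _ i).memLp_indicator _ 2
    refine le_trans (le_of_eq ?_) (eLpNorm_sub_le h.1.aestronglyMeasurable
      (h.1.sub hs).aestronglyMeasurable one_le_two)
    congr 1 with z
    simp
  have hlim2 : Tendsto (fun n => 2 * gaussianMoment p *
      (eLpNorm g 2 baseMeasure + ((ns n : ENNReal) + 1)⁻¹)) atTop
      (𝓝 (2 * gaussianMoment p * (eLpNorm g 2 baseMeasure + 0))) :=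
    ENNReal.Tendsto.const_mul (tendsto_const_nhds.add (h0.comp hns.tendsto_atTop))
      (Or.inr (ENNReal.mul_ne_top (by simp) (gaussianMoment_ne_top hp')))
  rw [add_zero] at hlim2
  exact (liminf_le_liminf (Eventually.of_forall hb)).trans hlim2.liminf_eq.le

end WienerIntegral

/-! ### Discrete Fourier analysis, aliasing and a Nikolskii inequality -/

section DiscreteFourier

lemma norm_fourier_apply (k : ℤ) (x : UnitAddCircle) : ‖(fourier k x : ℂ)‖ = 1 := by
  rw [fourier_apply]
  exact Circle.norm_coe _

lemma fourier_add_apply (k : ℤ) (x y : UnitAddCircle) :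
    (fourier k (x + y) : ℂ) = fourier k x * fourier k y := by
  simp [fourier_apply, AddCircle.toCircle_add]

lemma fourier_neg_apply (k : ℤ) (x : UnitAddCircle) :
    (fourier k (-x) : ℂ) = fourier (-k) x := by
  simp [fourier_apply]

lemma fourier_gridPoint (n : ℕ) (k : ℤ) (i : Fin (2 * n)) :
    (fourier k (gridPoint n i) : ℂ) =
      Complex.exp (2 * Real.pi * Complex.I * k / (2 * n)) ^ (i : ℕ) := by
  rw [gridPoint, fourier_coe_apply, ← Complex.exp_nat_mul]
  congr 1
  push_cast
  ring

lemma exp_eq_one_iff_dvd {n : ℕ} (hn : 1 ≤ n) (k : ℤ) :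
    Complex.exp (2 * Real.pi * Complex.I * k / (2 * n)) = 1 ↔ (2 * n : ℤ) ∣ k := by
  have hn' : (n : ℂ) ≠ 0 := by exact_mod_cast (by omega : n ≠ 0)
  have hpi : (Real.pi : ℂ) ≠ 0 := by exact_mod_cast Real.pi_ne_zero
  rw [Complex.exp_eq_one_iff]
  constructor
  · rintro ⟨r, hr⟩
    refine ⟨r, ?_⟩
    have : (k : ℂ) = 2 * n * r := by
      field_simp at hr
      linear_combination hr
    exact_mod_cast this
  · rintro ⟨r, rfl⟩
    refine ⟨r, ?_⟩
    push_cast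
    field_simp

/-- Discrete orthogonality of the characters. -/
lemma sum_fourier_gridPoint {n : ℕ} (hn : 1 ≤ n) (k : ℤ) :
    ∑ i, (fourier k (gridPoint n i) : ℂ) = if (2 * n : ℤ) ∣ k then 2 * (n : ℂ) else 0 := by
  simp only [fourier_gridPoint]
  set z := Complex.exp (2 * Real.pi * Complex.I * k / (2 * n)) with hz
  rw [Fin.sum_univ_eq_sum_range (fun i => z ^ i)]
  split_ifs with h
  · rw [(exp_eq_one_iff_dvd hn k).2 h] at hz
    simp [hz]
  · have h1 : z ≠ 1 := fun h1 => h ((exp_eq_one_iff_dvd hn k).1 h1)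
    have h2 : z ^ (2 * n) = 1 := by
      rw [hz, ← Complex.exp_nat_mul, Complex.exp_eq_one_iff]
      refine ⟨k, ?_⟩
      have hn' : (n : ℂ) ≠ 0 := by exact_mod_cast (by omega : n ≠ 0)
      push_cast
      field_simp
    rw [geom_sum_eq h1, h2]
    simp

/-- Aliasing: the grid cannot tell apart two frequencies congruent modulo `2n`, and separates all
others orthogonally. -/
lemma discreteFourierCoeff_fourier {n : ℕ} (hn : 1 ≤ n) (l k : ℤ) :
    discreteFourierCoeff n (restrictGrid n (fun x => (fourier l x : ℂ))) k =
      if (2 * n : ℤ) ∣ l - k then 1 else 0 := by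
  have hn' : (n : ℂ) ≠ 0 := by exact_mod_cast (by omega : n ≠ 0)
  have : ∀ i : Fin (2 * n), (fourier l (gridPoint n i) : ℂ) *
      starRingEnd ℂ (fourier k (gridPoint n i)) = fourier (l - k) (gridPoint n i) := fun i => by
    rw [← fourier_neg, ← fourier_add, sub_eq_add_neg]
  simp only [discreteFourierCoeff, restrictGrid, this, sum_fourier_gridPoint hn]
  split_ifs <;> simp
  field_simp

lemma int_dvd_sub_iff {n : ℕ} {k l : ℤ} (hk : k ∈ Finset.Ico (-(n : ℤ)) n)
    (hl : l ∈ Finset.Ico (-(n : ℤ)) n) : (2 * n : ℤ) ∣ k - l ↔ k = l := by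
  rw [Finset.mem_Ico] at hk hl
  constructor
  · rintro ⟨r, hr⟩
    have h1 : r < 1 := by nlinarith
    have h2 : -1 < r := by nlinarith
    have : r = 0 := by omega
    subst this
    linarith
  · rintro rfl
    simp

lemma discreteFourierCoeff_fourier_of_mem {n : ℕ} {l k : ℤ} (hl : l ∈ Finset.Ico (-(n : ℤ)) n)
    (hk : k ∈ Finset.Ico (-(n : ℤ)) n) :
    discreteFourierCoeff n (restrictGrid n (fourier (T := (1 : ℝ)) l)) k =
      if l = k then 1 else 0 := by
  have hn : 1 ≤ n := by
    rw [Finset.mem_Ico] at hl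
    omega
  refine (discreteFourierCoeff_fourier hn l k).trans ?_
  simp only [int_dvd_sub_iff hl hk]

lemma discreteFourierCoeff_sum {n : ℕ} {ι : Type*} (s : Finset ι) (a : ι → ℂ)
    (f : ι → Fin (2 * n) → ℂ) (k : ℤ) :
    discreteFourierCoeff n (fun i => ∑ j ∈ s, a j * f j i) k =
      ∑ j ∈ s, a j * discreteFourierCoeff n (f j) k := by
  simp only [discreteFourierCoeff, Finset.sum_mul, Finset.mul_sum]
  rw [Finset.sum_comm]
  refine Finset.sum_congr rfl fun j _ => Finset.sum_congr rfl fun i _ => ?_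
  ring

lemma norm_discreteFourierCoeff_le {n : ℕ} (hn : 1 ≤ n) {f : Fin (2 * n) → ℂ} {C : ℝ}
    (hf : ∀ i, ‖f i‖ ≤ C) (k : ℤ) : ‖discreteFourierCoeff n f k‖ ≤ C := by
  have hn' : (0 : ℝ) < n := by exact_mod_cast hn
  rw [discreteFourierCoeff, norm_mul]
  have h1 : ‖∑ i, f i * starRingEnd ℂ (fourier k (gridPoint n i))‖ ≤ 2 * n * C := by
    refine (norm_sum_le_of_le (f := fun i => f i * starRingEnd ℂ (fourier k (gridPoint n i)))
      (n := fun _ => C) _ fun i _ => ?_).trans (by simp)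
    rw [norm_mul, RCLike.norm_conj, norm_fourier_apply, mul_one]
    exact hf i
  have h2 : ‖(1 / (2 * n) : ℂ)‖ = 1 / (2 * n) := by simp
  rw [h2, div_mul_eq_mul_div, one_mul, div_le_iff₀ (by positivity)]
  linarith

lemma discreteFourierCoeff_sub (n : ℕ) (f g : Fin (2 * n) → ℂ) (k : ℤ) :
    discreteFourierCoeff n (fun i => f i - g i) k =
      discreteFourierCoeff n f k - discreteFourierCoeff n g k := by
  simp only [discreteFourierCoeff, sub_mul, Finset.sum_sub_distrib, mul_sub]

lemma norm_fourierCoeff_le {f : UnitAddCircle → ℂ} {C : ℝ} (hf : ∀ x, ‖f x‖ ≤ C) (k : ℤ) :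
    ‖fourierCoeff f k‖ ≤ C := by
  rw [fourierCoeff]
  refine (norm_integral_le_of_norm_le_const (C := C) (ae_of_all _ fun x => ?_)).trans (by simp)
  rw [norm_smul, norm_fourier_apply, one_mul]
  exact hf x

/-- The discrete Fourier coefficients of a continuous function converge to its Fourier
coefficients. -/
theorem tendsto_discreteFourierCoeff (f : C(UnitAddCircle, ℂ)) (k : ℤ) :
    Tendsto (fun M : ℕ => discreteFourierCoeff M (restrictGrid M f) k) atTop
      (𝓝 (fourierCoeff f k)) := by
  -- For a trigonometric polynomial the two coefficients agree once the grid is too fine for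
  -- aliasing. Density in the uniform norm extends the limit to `f`, since both functionals are
  -- bounded by the sup norm.
  have hspan : ∀ g ∈ Submodule.span ℂ (range (fourier (T := (1 : ℝ)))),
      Tendsto (fun M : ℕ => discreteFourierCoeff M (restrictGrid M g) k) atTop
        (𝓝 (fourierCoeff g k)) := by
    intro g hg
    induction hg using Submodule.span_induction with
    | mem g hg =>
      obtain ⟨l, rfl⟩ := hg
      rw [fourierCoeff_fourier]
      refine tendsto_const_nhds.congr' ?_
      filter_upwards [eventually_ge_atTop (l.natAbs + k.natAbs + 1)] with M hM
      rw [discreteFourierCoeff_fourier_of_mem (by rw [Finset.mem_Ico]; omega)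
        (by rw [Finset.mem_Ico]; omega)]
      by_cases h : l = k
      · subst h; simp
      · simp [h, Ne.symm h]
    | zero =>
      have h1 : fourierCoeff (⇑(0 : C(UnitAddCircle, ℂ))) k = 0 := by simp [fourierCoeff]
      rw [h1]
      simp [discreteFourierCoeff, restrictGrid]
    | add g₁ g₂ _ _ h₁ h₂ =>
      have h := h₁.add h₂
      have hi : ∀ g : C(UnitAddCircle, ℂ), Integrable g AddCircle.haarAddCircle := fun g =>
        g.continuous.integrable_of_hasCompactSupport (HasCompactSupport.of_compactSpace g)
      rw [ContinuousMap.coe_add, fourierCoeff.add (hi _) (hi _)]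
      refine h.congr fun M => ?_
      simp [discreteFourierCoeff, restrictGrid, add_mul, Finset.sum_add_distrib, mul_add]
    | smul a g _ h =>
      have h := h.const_mul a
      rw [ContinuousMap.coe_smul, fourierCoeff.const_smul, smul_eq_mul]
      refine h.congr fun M => ?_
      simp [discreteFourierCoeff, restrictGrid, Finset.mul_sum, mul_assoc, mul_left_comm]
  have hdense : f ∈ closure
      (Submodule.span ℂ (range (fourier (T := (1 : ℝ)))) : Set C(UnitAddCircle, ℂ)) := by
    have : f ∈ (Submodule.span ℂ (range (fourier (T := (1 : ℝ))))).topologicalClosure := by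
      rw [span_fourier_closure_eq_top]; trivial
    exact this
  rw [Metric.tendsto_atTop]
  intro ε hε
  obtain ⟨g, hg, hfg⟩ := Metric.mem_closure_iff.1 hdense (ε / 3) (by positivity)
  obtain ⟨N, hN⟩ := Metric.tendsto_atTop.1 (hspan g hg) (ε / 3) (by positivity)
  have hpt : ∀ x, ‖f x - g x‖ ≤ ε / 3 := fun x => by
    rw [← dist_eq_norm]
    exact (ContinuousMap.dist_apply_le_dist x).trans hfg.le
  have hcoef : ‖fourierCoeff f k - fourierCoeff g k‖ ≤ ε / 3 := by
    have hi : ∀ g : C(UnitAddCircle, ℂ),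
        Integrable (fun x => fourier (-k) x • g x) AddCircle.haarAddCircle := fun g =>
      Continuous.integrable_of_hasCompactSupport (by fun_prop)
        (HasCompactSupport.of_compactSpace _)
    have : fourierCoeff f k - fourierCoeff g k = fourierCoeff (fun x => f x - g x) k := by
      simp only [fourierCoeff]
      rw [← integral_sub (hi f) (hi g)]
      simp only [smul_sub]
    rw [this]
    exact norm_fourierCoeff_le hpt k
  -- The bound on discrete coefficients needs a nonempty grid, hence `M ≥ 1`.
  refine ⟨max N 1, fun M hM => ?_⟩
  have hM1 := hN M ((le_max_left _ _).trans hM)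
  have hM2 : ‖discreteFourierCoeff M (restrictGrid M f) k -
      discreteFourierCoeff M (restrictGrid M g) k‖ ≤ ε / 3 := by
    rw [← discreteFourierCoeff_sub]
    exact norm_discreteFourierCoeff_le ((le_max_right _ _).trans hM) (fun i => hpt _) k
  rw [dist_eq_norm] at hM1 ⊢
  have h4 : discreteFourierCoeff M (restrictGrid M f) k - fourierCoeff f k =
      (discreteFourierCoeff M (restrictGrid M f) k -
        discreteFourierCoeff M (restrictGrid M g) k) +
      (discreteFourierCoeff M (restrictGrid M g) k - fourierCoeff g k) -
      (fourierCoeff f k - fourierCoeff g k) := by ring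
  rw [h4]
  refine (norm_sub_le _ _).trans_lt ?_
  have h5 := norm_add_le (discreteFourierCoeff M (restrictGrid M f) k -
        discreteFourierCoeff M (restrictGrid M g) k)
      (discreteFourierCoeff M (restrictGrid M g) k - fourierCoeff g k)
  linarith

/-- Trigonometric polynomials of degree at most `D`. -/
def trigPoly (D : ℕ) : Submodule ℂ C(UnitAddCircle, ℂ) :=
  Submodule.span ℂ (fourier '' Icc (-(D : ℤ)) D)

lemma fourier_mem_trigPoly {D : ℕ} {k : ℤ} (hk : k ∈ Icc (-(D : ℤ)) D) :
    fourier k ∈ trigPoly D := Submodule.subset_span ⟨k, hk, rfl⟩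

lemma mul_mem_trigPoly {D E : ℕ} {f g : C(UnitAddCircle, ℂ)} (hf : f ∈ trigPoly D)
    (hg : g ∈ trigPoly E) : f * g ∈ trigPoly (D + E) := by
  have h : f * g ∈ trigPoly D * trigPoly E := Submodule.mul_mem_mul hf hg
  rw [trigPoly, trigPoly, Submodule.span_mul_span] at h
  refine Submodule.span_mono ?_ h
  rintro _ ⟨_, ⟨k, hk, rfl⟩, _, ⟨l, hl, rfl⟩, rfl⟩
  refine ⟨k + l, ?_, ?_⟩
  · rw [mem_Icc] at *
    push_cast
    constructor <;> linarith [hk.1, hk.2, hl.1, hl.2]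
  · ext x
    simp

lemma pow_mem_trigPoly {D : ℕ} {f : C(UnitAddCircle, ℂ)} (hf : f ∈ trigPoly D) (p : ℕ) :
    f ^ p ∈ trigPoly (p * D) := by
  induction p with
  | zero =>
    have : (1 : C(UnitAddCircle, ℂ)) = fourier 0 := by ext x; simp
    rw [pow_zero, this]
    exact fourier_mem_trigPoly (by simp)
  | succ p ih =>
    rw [pow_succ, Nat.succ_mul]
    exact mul_mem_trigPoly ih hf

/-- Interpolation on `2N` points is exact in degree below `N`, and each of the `2N` coefficients is
at most the mean of `‖f‖` over the grid. -/
lemma norm_apply_le_sum_gridPoint {D N : ℕ} (hDN : D < N) {f : C(UnitAddCircle, ℂ)}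
    (hf : f ∈ trigPoly D) (x : UnitAddCircle) : ‖f x‖ ≤ ∑ i, ‖f (gridPoint N i)‖ := by
  have hN : 1 ≤ N := by omega
  have hN' : (N : ℝ) ≠ 0 := by exact_mod_cast (by omega : N ≠ 0)
  have hrep : f x = ∑ k ∈ Finset.Ico (-(N : ℤ)) N,
      discreteFourierCoeff N (restrictGrid N f) k * fourier k x := by
    induction hf using Submodule.span_induction with
    | mem g hg =>
      obtain ⟨l, hl, rfl⟩ := hg
      have hl' : l ∈ Finset.Ico (-(N : ℤ)) N := by
        rw [mem_Icc] at hl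
        rw [Finset.mem_Ico]
        omega
      rw [Finset.sum_eq_single l]
      · rw [discreteFourierCoeff_fourier_of_mem hl' hl', if_pos rfl, one_mul]
      · intro k hk hkl
        rw [discreteFourierCoeff_fourier_of_mem hl' hk, if_neg hkl.symm, zero_mul]
      · exact fun h => absurd hl' h
    | zero => simp [discreteFourierCoeff, restrictGrid]
    | add g₁ g₂ _ _ h₁ h₂ =>
      rw [ContinuousMap.add_apply, h₁, h₂, ← Finset.sum_add_distrib]
      refine Finset.sum_congr rfl fun k _ => ?_
      simp [discreteFourierCoeff, restrictGrid, add_mul, Finset.sum_add_distrib, mul_add]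
    | smul a g _ h =>
      rw [ContinuousMap.smul_apply, h, smul_eq_mul, Finset.mul_sum]
      refine Finset.sum_congr rfl fun k _ => ?_
      rw [← mul_assoc]
      congr 1
      simp [discreteFourierCoeff, restrictGrid, Finset.mul_sum, mul_assoc, mul_left_comm]
  have hc : ∀ k, ‖discreteFourierCoeff N (restrictGrid N f) k * fourier k x‖ ≤
      1 / (2 * N) * ∑ i, ‖f (gridPoint N i)‖ := by
    intro k
    rw [norm_mul, norm_fourier_apply, mul_one, discreteFourierCoeff, norm_mul]
    have h2 : ‖(1 / (2 * N) : ℂ)‖ = 1 / (2 * N) := by simp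
    rw [h2]
    gcongr
    refine (norm_sum_le _ _).trans (Finset.sum_le_sum fun i _ => ?_)
    rw [norm_mul, RCLike.norm_conj, norm_fourier_apply, mul_one]
    rfl
  rw [hrep]
  refine (norm_sum_le_of_le _ fun k _ => hc k).trans (le_of_eq ?_)
  rw [Finset.sum_const, Int.card_Ico, nsmul_eq_mul]
  have : (((N : ℤ) - -(N : ℤ)).toNat : ℝ) = 2 * N := by
    have : ((N : ℤ) - -(N : ℤ)).toNat = 2 * N := by omega
    rw [this]; push_cast; ring
  rw [this]
  field_simp

/-- A Nikolskii inequality: the `p`-th power of the maximum of a trigonometric polynomial is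
controlled by its values on a sufficiently fine grid. -/
theorem norm_pow_le_sum_gridPoint {D N p : ℕ} (hN : p * D < N) {f : C(UnitAddCircle, ℂ)}
    (hf : f ∈ trigPoly D) (x : UnitAddCircle) :
    ‖f x‖ ^ p ≤ ∑ i, ‖f (gridPoint N i)‖ ^ p := by
  -- The `ℓ¹` bound is applied to `f ^ p`, of degree at most `p * D`.
  simpa using norm_apply_le_sum_gridPoint hN (pow_mem_trigPoly hf p) x

end DiscreteFourier

/-! ### Comparison of the heat and scheme multipliers -/

section KernelEstimates

/-- The Fourier multiplier of the heat semigroup. -/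
def heatFactor (k : ℤ) (τ : ℝ) : ℝ := Real.exp (-4 * Real.pi ^ 2 * (k : ℝ) ^ 2 * τ)

/-- The Fourier multiplier of the finite difference scheme. -/
def schemeFactor (c : ℝ) (n : ℕ) (k : ℤ) (τ : ℝ) : ℝ :=
  (1 + timeStep c n * discreteEigenvalue n k) ^ (kappa c n τ / timeStep c n)

/-- Spatial consistency: the symbols of the continuous and the discrete Laplacian differ at fourth
order. -/
lemma sq_sub_sin_sq_le (x : ℝ) (hx : |x| ≤ Real.pi) : x ^ 2 - Real.sin x ^ 2 ≤ 2 * x ^ 4 := by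
  wlog h0 : 0 ≤ x generalizing x with H
  · have := H (-x) (by rwa [abs_neg]) (by linarith)
    simpa [Real.sin_neg, Even.neg_pow (by decide : Even 4)] using this
  rw [abs_of_nonneg h0] at hx
  have hs : 0 ≤ Real.sin x := Real.sin_nonneg_of_nonneg_of_le_pi h0 hx
  have hs' : Real.sin x ≤ x := Real.sin_le h0
  have h3 : x - Real.sin x ≤ x ^ 3 := by
    rcases h0.eq_or_lt with rfl | hpos
    · simp
    have := Real.sin_gt_sub_cube hpos
    have : 0 < x ^ 3 := by positivity
    linarith
  calc x ^ 2 - Real.sin x ^ 2 = (x - Real.sin x) * (x + Real.sin x) := by ring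
    _ ≤ x ^ 3 * (2 * x) := by
      apply mul_le_mul h3 (by linarith) (by linarith) (by positivity)
    _ = 2 * x ^ 4 := by ring

/-- Temporal consistency of one explicit Euler step. -/
lemma exp_neg_sub_le {θ : ℝ} (hθ : 0 ≤ θ) : Real.exp (-θ) - (1 - θ) ≤ θ ^ 2 := by
  have h1 : Real.exp (-θ) ≤ 1 / (1 + θ) := by
    rw [Real.exp_neg, one_div]
    exact inv_anti₀ (by linarith) (by linarith [Real.add_one_le_exp θ])
  have h2 : 1 / (1 + θ) ≤ 1 - θ + θ ^ 2 := by
    rw [div_le_iff₀ (by linarith)]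
    nlinarith [pow_nonneg hθ 3]
  linarith

lemma mul_exp_neg_le_one (x : ℝ) : x * Real.exp (-x) ≤ 1 := by
  rw [Real.exp_neg, ← div_eq_mul_inv, div_le_one (Real.exp_pos x)]
  linarith [Real.add_one_le_exp x]

/-- Telescoping; the remaining factor `r ^ m` retains the exponential decay in time. -/
lemma abs_pow_sub_pow_le {a b r : ℝ} (ha : 0 ≤ a) (hb : 0 ≤ b) (har : a ≤ r) (hbr : b ≤ r)
    (m : ℕ) : |a ^ (m + 1) - b ^ (m + 1)| ≤ (m + 1) * |a - b| * r ^ m := by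
  induction m with
  | zero => simp
  | succ m ih =>
    have hr : 0 ≤ r := ha.trans har
    have : a ^ (m + 1 + 1) - b ^ (m + 1 + 1) =
        a * (a ^ (m + 1) - b ^ (m + 1)) + (a - b) * b ^ (m + 1) := by ring
    rw [this]
    calc _ ≤ |a * (a ^ (m + 1) - b ^ (m + 1))| + |(a - b) * b ^ (m + 1)| := abs_add_le _ _
      _ = a * |a ^ (m + 1) - b ^ (m + 1)| + |a - b| * b ^ (m + 1) := by
        rw [abs_mul, abs_mul, abs_of_nonneg ha, abs_of_nonneg (pow_nonneg hb _)]
      _ ≤ r * ((m + 1) * |a - b| * r ^ m) + |a - b| * r ^ (m + 1) := by gcongr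
      _ = ((m + 1 : ℕ) + 1) * |a - b| * r ^ (m + 1) := by push_cast; ring

variable {c : ℝ} {n : ℕ} {k : ℤ}

lemma timeStep_pos (hc : c ∈ Ioc (0 : ℝ) (1 / 8)) (hn : 1 ≤ n) : 0 < timeStep c n := by
  have hn' : (0 : ℝ) < n := by exact_mod_cast hn
  have := hc.1
  unfold timeStep
  positivity

lemma timeStep_mul_sq (hn : 1 ≤ n) : timeStep c n * n ^ 2 = c / 4 := by
  have hn' : (n : ℝ) ≠ 0 := by exact_mod_cast (by omega : n ≠ 0)
  unfold timeStep
  field_simp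
  norm_num

lemma sq_le_of_mem_Icc (hk : k ∈ Finset.Icc (-(n : ℤ)) n) : (k : ℝ) ^ 2 ≤ (n : ℝ) ^ 2 := by
  rw [Finset.mem_Icc] at hk
  exact sq_le_sq' (by exact_mod_cast hk.1) (by exact_mod_cast hk.2)

lemma timeStep_mul_freq_sq_le (hc : c ∈ Ioc (0 : ℝ) (1 / 8)) (hn : 1 ≤ n)
    (hk : k ∈ Finset.Icc (-(n : ℤ)) n) : timeStep c n * (k : ℝ) ^ 2 ≤ 1 / 32 := by
  have h1 := timeStep_pos hc hn
  have h2 := timeStep_mul_sq (c := c) hn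
  have h3 := mul_le_mul_of_nonneg_left (sq_le_of_mem_Icc hk) h1.le
  linarith [hc.2]

lemma one_add_eigenvalue (hn : 1 ≤ n) : 1 + timeStep c n * discreteEigenvalue n k =
    1 - 4 * c * Real.sin (k * Real.pi / (2 * n)) ^ 2 := by
  have := timeStep_mul_sq (c := c) hn
  unfold discreteEigenvalue
  linear_combination -16 * Real.sin (k * Real.pi / (2 * n)) ^ 2 * this

lemma abs_arg_le (hn : 1 ≤ n) (hk : k ∈ Finset.Icc (-(n : ℤ)) n) :
    |(k : ℝ) * Real.pi / (2 * n)| ≤ Real.pi / 2 := by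
  have hn' : (0 : ℝ) < n := by exact_mod_cast hn
  have h := abs_le_of_sq_le_sq (sq_le_of_mem_Icc hk) hn'.le
  rw [abs_div, abs_mul, abs_of_pos Real.pi_pos, abs_of_pos (by positivity : (0 : ℝ) < 2 * n),
    div_le_iff₀ (by positivity)]
  nlinarith [Real.pi_pos]

/-- The restriction `c ≤ 1/8` makes `4c sin² ≤ 1/2`, so the one-step multiplier cannot change sign.
-/
lemma one_add_eigenvalue_nonneg (hc : c ∈ Ioc (0 : ℝ) (1 / 8)) (hn : 1 ≤ n) :
    0 ≤ 1 + timeStep c n * discreteEigenvalue n k := by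
  rw [one_add_eigenvalue hn]
  have h1 := Real.sin_sq_le_one (k * Real.pi / (2 * n))
  nlinarith [hc.1, hc.2, sq_nonneg (Real.sin (k * Real.pi / (2 * n)))]

/-- Jordan's inequality `|sin x| ≥ (2/π)|x|` gives `sin² ≥ k²/n²`, hence parabolic decay of the
scheme uniformly in `n` and `c`. -/
lemma one_add_eigenvalue_le (hc : c ∈ Ioc (0 : ℝ) (1 / 8)) (hn : 1 ≤ n)
    (hk : k ∈ Finset.Icc (-(n : ℤ)) n) : 1 + timeStep c n * discreteEigenvalue n k ≤
      Real.exp (-(16 * k ^ 2 * timeStep c n)) := by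
  have hn' : (0 : ℝ) < n := by exact_mod_cast hn
  rw [one_add_eigenvalue hn]
  refine le_trans ?_ (Real.one_sub_le_exp_neg _)
  have h1 := Real.mul_abs_le_abs_sin (abs_arg_le hn hk)
  have h2 : 2 / Real.pi * |(k : ℝ) * Real.pi / (2 * n)| = |(k : ℝ)| / n := by
    rw [abs_div, abs_mul, abs_of_pos Real.pi_pos, abs_of_pos (by positivity : (0 : ℝ) < 2 * n)]
    have := Real.pi_ne_zero
    field_simp
  rw [h2] at h1
  have h3 : (k : ℝ) ^ 2 / n ^ 2 ≤ Real.sin (k * Real.pi / (2 * n)) ^ 2 := by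
    have := pow_le_pow_left₀ (by positivity) h1 2
    rwa [div_pow, sq_abs, sq_abs] at this
  have h4 : 16 * (k : ℝ) ^ 2 * timeStep c n = 4 * c * ((k : ℝ) ^ 2 / n ^ 2) := by
    unfold timeStep
    field_simp
    ring
  rw [h4]
  have := mul_le_mul_of_nonneg_left h3 (by linarith [hc.1] : 0 ≤ 4 * c)
  linarith

lemma exp_step_le (hc : c ∈ Ioc (0 : ℝ) (1 / 8)) (hn : 1 ≤ n)
    (hk : k ∈ Finset.Icc (-(n : ℤ)) n) : Real.exp (16 * k ^ 2 * timeStep c n) ≤ 7 / 4 := by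
  have h := timeStep_mul_freq_sq_le hc hn hk
  have h1 : Real.exp (1 / 2) ≤ 7 / 4 := by
    have h2 : Real.exp (1 / 2) ^ 2 = Real.exp 1 := by rw [← Real.exp_nat_mul]; norm_num
    have h3 := Real.exp_one_lt_d9
    exact abs_le_of_sq_le_sq' (by rw [h2]; linarith) (by norm_num) |>.2
  exact (Real.exp_le_exp.2 (by linarith)).trans h1

lemma schemeFactor_eq_pow (hc : c ∈ Ioc (0 : ℝ) (1 / 8)) (hn : 1 ≤ n) {τ : ℝ} (hτ : 0 ≤ τ) :
    schemeFactor c n k τ =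
      (1 + timeStep c n * discreteEigenvalue n k) ^ ⌊τ / timeStep c n⌋₊ := by
  have h := timeStep_pos hc hn
  rw [schemeFactor, kappa, mul_div_cancel_right₀ _ h.ne',
    ← natCast_floor_eq_intCast_floor (by positivity), Real.rpow_natCast]

/-- Rounding `τ/h` down loses at most one step, which costs at most `exp(16k²h) ≤ 7/4`. -/
lemma exp_pow_floor_le (hc : c ∈ Ioc (0 : ℝ) (1 / 8)) (hn : 1 ≤ n)
    (hk : k ∈ Finset.Icc (-(n : ℤ)) n) {τ : ℝ} :
    Real.exp (-(16 * k ^ 2 * timeStep c n)) ^ ⌊τ / timeStep c n⌋₊ ≤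
      7 / 4 * Real.exp (-(16 * k ^ 2 * τ)) := by
  have h := timeStep_pos hc hn
  have h1 : τ ≤ (⌊τ / timeStep c n⌋₊ + 1) * timeStep c n := by
    rw [← div_le_iff₀ h]
    exact (Nat.lt_floor_add_one _).le
  rw [← Real.exp_nat_mul]
  calc _ ≤ Real.exp (16 * k ^ 2 * timeStep c n + -(16 * k ^ 2 * τ)) := by
        apply Real.exp_le_exp.2
        have := mul_le_mul_of_nonneg_left h1 (by positivity : 0 ≤ 16 * (k : ℝ) ^ 2)
        linarith
    _ ≤ _ := by
      rw [Real.exp_add]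
      gcongr
      exact exp_step_le hc hn hk

lemma schemeFactor_nonneg (hc : c ∈ Ioc (0 : ℝ) (1 / 8)) (hn : 1 ≤ n) {τ : ℝ} :
    0 ≤ schemeFactor c n k τ :=
  Real.rpow_nonneg (one_add_eigenvalue_nonneg hc hn) _

lemma schemeFactor_le (hc : c ∈ Ioc (0 : ℝ) (1 / 8)) (hn : 1 ≤ n)
    (hk : k ∈ Finset.Icc (-(n : ℤ)) n) {τ : ℝ} (hτ : 0 ≤ τ) :
    schemeFactor c n k τ ≤ 2 * Real.exp (-(16 * k ^ 2 * τ)) := by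
  rw [schemeFactor_eq_pow hc hn hτ]
  refine (pow_le_pow_left₀ (one_add_eigenvalue_nonneg hc hn) (one_add_eigenvalue_le hc hn hk)
    _).trans ((exp_pow_floor_le hc hn hk).trans ?_)
  gcongr
  norm_num

/-- With `x = kπ/(2n)` the difference is `(e^{-θ} - (1-θ)) - 4c(x² - sin² x)`, where `θ = 4cx²`.
Both brackets are nonnegative and of order `c x⁴`, that is `h k⁴/n²`. The constant 250 comes from
`π⁴ ≤ 100`. -/
lemma one_step_error (hc : c ∈ Ioc (0 : ℝ) (1 / 8)) (hn : 1 ≤ n)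
    (hk : k ∈ Finset.Icc (-(n : ℤ)) n) :
    |Real.exp (-(4 * Real.pi ^ 2 * k ^ 2 * timeStep c n)) -
      (1 + timeStep c n * discreteEigenvalue n k)| ≤ 250 * timeStep c n * k ^ 4 / n ^ 2 := by
  have hn' : (0 : ℝ) < n := by exact_mod_cast hn
  set x : ℝ := k * Real.pi / (2 * n) with hx
  have hx1 : |x| ≤ Real.pi / 2 := abs_arg_le hn hk
  have hθ : 4 * Real.pi ^ 2 * (k : ℝ) ^ 2 * timeStep c n = 4 * c * x ^ 2 := by
    rw [hx]
    unfold timeStep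
    field_simp
  rw [one_add_eigenvalue hn, hθ]
  have h1 := sq_sub_sin_sq_le x (by linarith [Real.pi_pos])
  have h2 : Real.sin x ^ 2 ≤ x ^ 2 := sq_le_sq.2 (Real.abs_sin_le_abs)
  have hc0 := hc.1
  have h3 := exp_neg_sub_le (by positivity : 0 ≤ 4 * c * x ^ 2)
  have h4 := Real.one_sub_le_exp_neg (4 * c * x ^ 2)
  have h5 : 250 * timeStep c n * k ^ 4 / n ^ 2 = 1000 / Real.pi ^ 4 * (c * x ^ 4) := by
    rw [hx]
    have := Real.pi_ne_zero
    unfold timeStep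
    field_simp
    ring
  have h6 : 10 ≤ 1000 / Real.pi ^ 4 := by
    rw [le_div_iff₀ (by positivity)]
    have h7 := Real.pi_lt_d2
    have : Real.pi ^ 4 ≤ 3.15 ^ 4 := by gcongr
    linarith
  have h7 : 0 ≤ c * x ^ 4 := by positivity
  have h8 : (4 * c * x ^ 2) ^ 2 ≤ 2 * (c * x ^ 4) := by
    have : (4 * c * x ^ 2) ^ 2 = 16 * c * (c * x ^ 4) := by ring
    rw [this]
    gcongr
    linarith [hc.2]
  have h9 : c * (x ^ 2 - Real.sin x ^ 2) ≤ c * (2 * x ^ 4) := by gcongr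
  have h10 : 0 ≤ c * (x ^ 2 - Real.sin x ^ 2) := mul_nonneg hc0.le (by linarith)
  rw [h5, abs_le]
  constructor <;> nlinarith

/-- The error between the multipliers of the heat semigroup and of the scheme. -/
theorem abs_heatFactor_sub_schemeFactor_le (hc : c ∈ Ioc (0 : ℝ) (1 / 8)) (hn : 1 ≤ n)
    (hk : k ∈ Finset.Icc (-(n : ℤ)) n) {τ : ℝ} (hτ : 0 ≤ τ) :
    |heatFactor k τ - schemeFactor c n k τ| ≤
      100 * (k ^ 2 / n ^ 2) * Real.exp (-(8 * k ^ 2 * τ)) := by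
  have hn' : (0 : ℝ) < n := by exact_mod_cast hn
  set h := timeStep c n with hh
  have hpos : 0 < h := timeStep_pos hc hn
  set m := ⌊τ / h⌋₊ with hm
  have hmτ : m * h ≤ τ := by
    rw [← le_div_iff₀ hpos]
    exact Nat.floor_le (by positivity)
  have hτm : τ ≤ m * h + h := by
    have : τ ≤ (m + 1) * h := by
      rw [← div_le_iff₀ hpos]
      exact (Nat.lt_floor_add_one _).le
    linarith
  set b := Real.exp (-(4 * Real.pi ^ 2 * k ^ 2 * h)) with hb
  set r := Real.exp (-(16 * k ^ 2 * h)) with hr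
  set E := Real.exp (-(16 * k ^ 2 * τ)) with hE
  set a := 1 + h * discreteEigenvalue n k with ha
  have hrm : r ^ m ≤ 7 / 4 * E := exp_pow_floor_le hc hn hk
  have hpi : 3 < Real.pi := Real.pi_gt_three
  have hbr : b ≤ r := by
    apply Real.exp_le_exp.2
    have : 16 * ((k : ℝ) ^ 2 * h) ≤ 4 * Real.pi ^ 2 * (k ^ 2 * h) := by
      gcongr
      nlinarith
    linarith
  have hkh : k ^ 2 * h ≤ 1 / 32 * (k ^ 2 / n ^ 2) := by
    have := timeStep_mul_sq (c := c) hn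
    rw [← mul_div_assoc, le_div_iff₀ (by positivity)]
    have h1 : (k : ℝ) ^ 2 * h * n ^ 2 = k ^ 2 * (c / 4) := by rw [← this]; ring
    rw [h1, mul_comm]
    exact mul_le_mul_of_nonneg_right (by linarith [hc.2]) (sq_nonneg _)
  have hE8 : E ≤ Real.exp (-(8 * k ^ 2 * τ)) := by
    apply Real.exp_le_exp.2
    nlinarith [mul_nonneg (sq_nonneg (k : ℝ)) hτ]
  have hE0 : 0 < E := Real.exp_pos _
  -- replacing `τ` by the grid time
  have hA : |heatFactor k τ - b ^ m| ≤ 5 / 2 * (k ^ 2 / n ^ 2) * E := by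
    have hbm : b ^ m = Real.exp (-(4 * Real.pi ^ 2 * k ^ 2 * (m * h))) := by
      rw [hb, ← Real.exp_nat_mul]
      congr 1
      ring
    have hle : heatFactor k τ = b ^ m * Real.exp (-(4 * Real.pi ^ 2 * k ^ 2 * (τ - m * h))) := by
      rw [hbm, heatFactor, ← Real.exp_add]
      congr 1
      ring
    have h1 := Real.one_sub_le_exp_neg (4 * Real.pi ^ 2 * k ^ 2 * (τ - m * h))
    have h2 : Real.exp (-(4 * Real.pi ^ 2 * k ^ 2 * (τ - m * h))) ≤ 1 := by
      apply Real.exp_le_one_iff.2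
      have : 0 ≤ τ - m * h := by linarith
      have : 0 ≤ 4 * Real.pi ^ 2 * k ^ 2 * (τ - m * h) := by positivity
      linarith
    have h3 : 4 * Real.pi ^ 2 * k ^ 2 * (τ - m * h) ≤ 40 * (k ^ 2 * h) := by
      have : 4 * Real.pi ^ 2 * k ^ 2 * (τ - m * h) = 4 * Real.pi ^ 2 * (k ^ 2 * (τ - m * h)) := by
        ring
      rw [this]
      have h4 : Real.pi ^ 2 ≤ 10 := by nlinarith [Real.pi_lt_d2]
      have h5 : 0 ≤ τ - m * h := by linarith
      gcongr <;> linarith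
    have hb0 : 0 ≤ b ^ m := by positivity
    have hbm' : b ^ m ≤ 7 / 4 * E :=
      (pow_le_pow_left₀ (Real.exp_pos _).le hbr m).trans hrm
    rw [hle, abs_sub_comm, abs_of_nonneg (by nlinarith)]
    calc b ^ m - b ^ m * Real.exp (-(4 * Real.pi ^ 2 * k ^ 2 * (τ - m * h)))
        = b ^ m * (1 - Real.exp (-(4 * Real.pi ^ 2 * k ^ 2 * (τ - m * h)))) := by ring
      _ ≤ (7 / 4 * E) * (40 * (1 / 32 * (k ^ 2 / n ^ 2))) := by
        apply mul_le_mul hbm' (by linarith) (by linarith) (by positivity)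
      _ ≤ 5 / 2 * (k ^ 2 / n ^ 2) * E := by
        have : 0 ≤ (k ^ 2 / n ^ 2 : ℝ) * E := by positivity
        linarith
  -- accumulating the one-step errors
  have hB : |b ^ m - a ^ m| ≤ 96 * (k ^ 2 / n ^ 2) * Real.exp (-(8 * k ^ 2 * τ)) := by
    rcases Nat.eq_zero_or_pos m with h0 | h0
    · rw [h0]
      simp only [pow_zero, sub_self, abs_zero]
      positivity
    obtain ⟨m', hm'⟩ : ∃ m', m = m' + 1 := ⟨m - 1, by omega⟩
    have h1 := abs_pow_sub_pow_le (Real.exp_pos _).le (one_add_eigenvalue_nonneg hc hn) hbr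
      (one_add_eigenvalue_le hc hn hk) m'
    rw [← hm'] at h1
    have h2 : |b - a| ≤ 250 * h * k ^ 4 / n ^ 2 := one_step_error hc hn hk
    -- Telescoping leaves one power of `r` fewer than `r ^ m`, which costs a second factor `7/4`.
    have h3 : r ^ m' ≤ 7 / 4 * (7 / 4 * E) := by
      have : r ^ m' = Real.exp (16 * k ^ 2 * h) * r ^ m := by
        have h4 : Real.exp (16 * k ^ 2 * h) * r = 1 := by
          rw [hr, ← Real.exp_add]
          simp
        rw [hm', pow_succ r m']
        linear_combination -r ^ m' * h4
      rw [this]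
      exact mul_le_mul (exp_step_le hc hn hk) hrm (by positivity) (by norm_num)
    -- Half of the decay absorbs the factor `k²τ` of the accumulated error through `x e^{-x} ≤ 1`;
    -- the other half survives in the bound.
    have h5 : E = Real.exp (-(8 * k ^ 2 * τ)) * Real.exp (-(8 * k ^ 2 * τ)) := by
      rw [hE, ← Real.exp_add]
      congr 1
      ring
    have h6 := mul_exp_neg_le_one (8 * k ^ 2 * τ)
    set F := Real.exp (-(8 * k ^ 2 * τ)) with hF
    have hF0 : 0 < F := Real.exp_pos _
    calc |b ^ m - a ^ m| ≤ (m' + 1) * |b - a| * r ^ m' := h1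
      _ ≤ (m' + 1) * (250 * h * k ^ 4 / n ^ 2) * (7 / 4 * (7 / 4 * E)) := by gcongr
      _ = (m * h) * (250 * k ^ 4 / n ^ 2) * (7 / 4 * (7 / 4 * E)) := by
        rw [hm']
        push_cast
        ring
      _ ≤ τ * (250 * k ^ 4 / n ^ 2) * (7 / 4 * (7 / 4 * E)) := by gcongr
      _ = 250 * (49 / 16) / 8 * (k ^ 2 / n ^ 2) * F * (8 * k ^ 2 * τ * F) := by
        rw [h5]
        ring
      _ ≤ 250 * (49 / 16) / 8 * (k ^ 2 / n ^ 2) * F * 1 := by gcongr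
      _ ≤ 96 * (k ^ 2 / n ^ 2) * F := by
        have : 0 ≤ (k ^ 2 / n ^ 2 : ℝ) * F := by positivity
        linarith
  rw [schemeFactor_eq_pow hc hn hτ]
  calc |heatFactor k τ - a ^ m| ≤ |heatFactor k τ - b ^ m| + |b ^ m - a ^ m| :=
        abs_sub_le _ _ _
    _ ≤ 5 / 2 * (k ^ 2 / n ^ 2) * Real.exp (-(8 * k ^ 2 * τ)) +
        96 * (k ^ 2 / n ^ 2) * Real.exp (-(8 * k ^ 2 * τ)) := by
      refine add_le_add (hA.trans ?_) hB
      gcongr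
    _ ≤ _ := by
      have : 0 ≤ (k ^ 2 / n ^ 2 : ℝ) * Real.exp (-(8 * k ^ 2 * τ)) := by positivity
      linarith

end KernelEstimates

/-! ### Cell errors and Bessel inequalities on the torus -/

section Torus

lemma volume_eq_haarAddCircle :
    (volume : Measure UnitAddCircle) = AddCircle.haarAddCircle := by
  rw [AddCircle.volume_eq_smul_haarAddCircle]
  simp

instance isProbabilityMeasure_volume : IsProbabilityMeasure (volume : Measure UnitAddCircle) := by
  rw [volume_eq_haarAddCircle]
  infer_instance

lemma coe_intCast_eq_zero (m : ℤ) : ((m : ℝ) : UnitAddCircle) = 0 := by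
  have h : ((m : ℝ) : UnitAddCircle) = m • ((1 : ℝ) : UnitAddCircle) := by
    rw [← AddCircle.coe_zsmul]
    simp
  rw [h, AddCircle.coe_period, smul_zero]

/-- Changing the real representative by an integer changes `2nr` by a multiple of `2n`, so the
formula holds beyond `[0,1)`; this frees translations from wrap-around cases. -/
lemma rho_coe {n : ℕ} (hn : 1 ≤ n) (r : ℝ) :
    rho n (r : UnitAddCircle) = ((⌊2 * n * r⌋ / (2 * n) : ℝ) : UnitAddCircle) := by
  have hn' : (n : ℝ) ≠ 0 := by exact_mod_cast (by omega : n ≠ 0)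
  rw [rho, AddCircle.coe_equivIco_mk_apply, div_one, mul_one]
  have h1 : 2 * n * Int.fract r = 2 * n * r - ((2 * n * ⌊r⌋ : ℤ) : ℝ) := by
    rw [Int.fract]
    push_cast
    ring
  have h2 : ((⌊2 * n * r⌋ - 2 * n * ⌊r⌋ : ℤ) : ℝ) / (2 * n) =
      ⌊2 * n * r⌋ / (2 * n) - (⌊r⌋ : ℝ) := by
    push_cast
    field_simp
  rw [h1, Int.floor_sub_intCast, h2, AddCircle.coe_sub, coe_intCast_eq_zero, sub_zero]

/-- Equivariance under the grid translation is the source of the orthogonality of cell errors. -/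
lemma rho_add_step {n : ℕ} (hn : 1 ≤ n) (y : UnitAddCircle) :
    rho n (y + ((1 / (2 * n) : ℝ) : UnitAddCircle)) =
      rho n y + ((1 / (2 * n) : ℝ) : UnitAddCircle) := by
  have hn' : (n : ℝ) ≠ 0 := by exact_mod_cast (by omega : n ≠ 0)
  induction y using QuotientAddGroup.induction_on with
  | H r =>
    change rho n ((r : UnitAddCircle) + _) = rho n (r : UnitAddCircle) + _
    rw [← AddCircle.coe_add, rho_coe hn, rho_coe hn, ← AddCircle.coe_add]
    have : 2 * n * (r + 1 / (2 * n)) = 2 * n * r + 1 := by field_simp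
    rw [this, Int.floor_add_one]
    congr 1
    push_cast
    ring

lemma measurable_rho (n : ℕ) : Measurable (rho n) := by
  have h1 : Measurable fun y : UnitAddCircle => (AddCircle.equivIco (1 : ℝ) 0 y : ℝ) :=
    measurable_subtype_coe.comp (AddCircle.measurableEquivIco (1 : ℝ) 0).measurable
  have h2 : Measurable fun y : UnitAddCircle =>
      ((⌊2 * n * (AddCircle.equivIco (1 : ℝ) 0 y : ℝ)⌋ : ℝ) / (2 * n) : ℝ) := by
    fun_prop
  exact AddCircle.measurable_mk'.comp h2

/-- The error made by evaluating the character `e_{-k}` at the grid point to the left. -/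
def cellError (n : ℕ) (k : ℤ) (y : UnitAddCircle) : ℂ :=
  fourier (-k) y - fourier (-k) (rho n y)

lemma measurable_cellError (n : ℕ) (k : ℤ) : Measurable (cellError n k) :=
  (fourier (-k)).continuous.measurable.sub
    ((fourier (-k)).continuous.measurable.comp (measurable_rho n))

/-- A cell has width `1/(2n)`, and `|e^{iθ} - 1| ≤ |θ|`. -/
lemma norm_cellError_le {n : ℕ} (hn : 1 ≤ n) (k : ℤ) (y : UnitAddCircle) :
    ‖cellError n k y‖ ≤ Real.pi * |(k : ℝ)| / n := by
  have hn' : (0 : ℝ) < n := by exact_mod_cast hn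
  induction y using QuotientAddGroup.induction_on with
  | H r =>
    change ‖(fourier (-k) (r : UnitAddCircle) : ℂ) - fourier (-k) (rho n (r : UnitAddCircle))‖ ≤ _
    rw [rho_coe hn]
    set r' : ℝ := ⌊2 * n * r⌋ / (2 * n) with hr'
    have h1 : r' ≤ r := by
      rw [hr', div_le_iff₀ (by positivity), mul_comm r]
      exact Int.floor_le _
    have h2 : r - r' ≤ 1 / (2 * n) := by
      have h3 : 2 * n * r' = ⌊2 * n * r⌋ := by
        rw [hr']
        field_simp
      rw [le_div_iff₀ (by positivity)]
      linarith [Int.lt_floor_add_one (2 * n * r)]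
    have hsplit : (fourier (-k) (r : UnitAddCircle) : ℂ) =
        fourier (-k) ((r - r' : ℝ) : UnitAddCircle) * fourier (-k) (r' : UnitAddCircle) := by
      rw [← fourier_add_apply, ← AddCircle.coe_add, sub_add_cancel]
    have hexp : (fourier (-k) ((r - r' : ℝ) : UnitAddCircle) : ℂ) =
        Complex.exp (Complex.I * ((2 * Real.pi * (-k) * (r - r') : ℝ) : ℂ)) := by
      rw [fourier_coe_apply]
      congr 1
      push_cast
      ring
    rw [hsplit, ← sub_one_mul, norm_mul, norm_fourier_apply, mul_one, hexp]
    refine Real.norm_exp_I_mul_ofReal_sub_one_le.trans ?_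
    rw [Real.norm_eq_abs, abs_mul, abs_mul, abs_mul, abs_neg, abs_of_pos Real.pi_pos, abs_two,
      abs_of_nonneg (sub_nonneg.2 h1)]
    calc 2 * Real.pi * |(k : ℝ)| * (r - r') ≤ 2 * Real.pi * |(k : ℝ)| * (1 / (2 * n)) := by
          have := Real.pi_pos
          gcongr
      _ = _ := by field_simp

lemma integral_fourier (k : ℤ) : ∫ y : UnitAddCircle, (fourier k y : ℂ) = if k = 0 then 1 else 0 := by
  have h := congrFun (fourierCoeff_fourier (T := (1 : ℝ)) k) 0
  simp only [fourierCoeff, neg_zero, fourier_zero, one_smul] at h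
  rw [volume_eq_haarAddCircle, h]
  by_cases hk : k = 0
  · subst hk; simp
  · simp [hk, Ne.symm hk]

lemma integral_fourier_mul_conj {k l : ℤ} (hkl : k ≠ l) :
    ∫ y : UnitAddCircle, (fourier (-k) y : ℂ) * starRingEnd ℂ (fourier (-l) y) = 0 := by
  have : ∀ y : UnitAddCircle, (fourier (-k) y : ℂ) * starRingEnd ℂ (fourier (-l) y) =
      fourier (l - k) y := fun y => by
    rw [← fourier_neg, ← fourier_add]
    congr 2
    ring
  simp only [this, integral_fourier]
  rw [if_neg (by omega)]

lemma fourier_step {n : ℕ} (hn : 1 ≤ n) {k : ℤ}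
    (hk : (fourier k ((1 / (2 * n) : ℝ) : UnitAddCircle) : ℂ) = 1) : (2 * n : ℤ) ∣ k := by
  rw [← exp_eq_one_iff_dvd hn, ← hk, fourier_coe_apply]
  congr 1
  push_cast
  ring

/-- The cell errors of different frequencies are orthogonal. -/
lemma integral_cellError_mul_conj {n : ℕ} (hn : 1 ≤ n) {k l : ℤ}
    (hk : k ∈ Finset.Ico (-(n : ℤ)) n) (hl : l ∈ Finset.Ico (-(n : ℤ)) n) (hkl : k ≠ l) :
    ∫ y, cellError n k y * starRingEnd ℂ (cellError n l y) = 0 := by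
  set v : UnitAddCircle := ((1 / (2 * n) : ℝ) : UnitAddCircle) with hv
  have hshift : ∀ j y, cellError n j (y + v) = fourier (-j) v * cellError n j y := fun j y => by
    simp only [cellError, hv, rho_add_step hn, fourier_add_apply]
    ring
  -- Translation by one cell preserves the integral `I` but multiplies its integrand by
  -- `e_{l-k}(v)`, so `I = e_{l-k}(v) I`. The scalar differs from 1 because `k` and `l` are distinct
  -- modulo `2n`.
  have h := integral_add_right_eq_self (μ := (volume : Measure UnitAddCircle))
    (fun y => cellError n k y * starRingEnd ℂ (cellError n l y)) v
  have h2 : ∀ y, cellError n k (y + v) * starRingEnd ℂ (cellError n l (y + v)) =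
      fourier (l - k) v * (cellError n k y * starRingEnd ℂ (cellError n l y)) := fun y => by
    rw [hshift, hshift, map_mul, ← fourier_neg, neg_neg, sub_eq_add_neg, fourier_add]
    ring
  simp only [h2] at h
  rw [integral_const_mul] at h
  have h3 : (fourier (l - k) v : ℂ) ≠ 1 := fun h4 => by
    have := (int_dvd_sub_iff hl hk).1 (fourier_step hn h4)
    exact hkl this.symm
  have h5 : ((fourier (l - k) v : ℂ) - 1) *
      ∫ y, cellError n k y * starRingEnd ℂ (cellError n l y) = 0 := by
    rw [sub_one_mul, h, sub_self]
  exact (mul_eq_zero.1 h5).resolve_left (sub_ne_zero.2 h3)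

/-- Bessel's identity for orthogonal bounded functions on the torus. -/
lemma lintegral_norm_sum_sq_le {ι : Type*} (s : Finset ι) (a : ι → ℂ) (f : ι → UnitAddCircle → ℂ)
    (B : ι → ℝ) (hf : ∀ i ∈ s, Measurable (f i)) (hB : ∀ i ∈ s, ∀ y, ‖f i y‖ ≤ B i)
    (horth : ∀ i ∈ s, ∀ j ∈ s, i ≠ j → ∫ y, f i y * starRingEnd ℂ (f j y) = 0) :
    ∫⁻ y, ENNReal.ofReal (‖∑ i ∈ s, a i * f i y‖ ^ 2) ≤
      ENNReal.ofReal (∑ i ∈ s, ‖a i‖ ^ 2 * B i ^ 2) := by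
  have hbd : ∀ g : UnitAddCircle → ℂ, Measurable g → (∃ C, ∀ y, ‖g y‖ ≤ C) → Integrable g := by
    rintro g hg ⟨C, hC⟩
    exact Integrable.of_bound hg.aestronglyMeasurable C (ae_of_all _ hC)
  have hint : ∀ i ∈ s, ∀ j ∈ s, Integrable fun y => f i y * starRingEnd ℂ (f j y) := by
    intro i hi j hj
    refine hbd _ ((hf i hi).mul (Complex.continuous_conj.measurable.comp (hf j hj)))
      ⟨B i * B j, fun y => ?_⟩
    rw [norm_mul, RCLike.norm_conj]
    exact mul_le_mul (hB i hi y) (hB j hj y) (norm_nonneg _) ((norm_nonneg _).trans (hB i hi y))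
  have hexp : ∀ y, ((‖∑ i ∈ s, a i * f i y‖ ^ 2 : ℝ) : ℂ) = ∑ i ∈ s, ∑ j ∈ s,
      (a i * starRingEnd ℂ (a j)) * (f i y * starRingEnd ℂ (f j y)) := by
    intro y
    rw [Complex.ofReal_pow, ← Complex.mul_conj', map_sum, Finset.sum_mul_sum]
    refine Finset.sum_congr rfl fun i _ => Finset.sum_congr rfl fun j _ => ?_
    rw [map_mul]
    ring
  have hI : ((∫ y, ‖∑ i ∈ s, a i * f i y‖ ^ 2 : ℝ) : ℂ) =
      ∑ i ∈ s, (a i * starRingEnd ℂ (a i)) * ∫ y, f i y * starRingEnd ℂ (f i y) := by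
    rw [← integral_complex_ofReal]
    simp only [hexp]
    rw [integral_finsetSum _ fun i hi => integrable_finsetSum _ fun j hj =>
      (hint i hi j hj).const_mul _]
    refine Finset.sum_congr rfl fun i hi => ?_
    rw [integral_finsetSum _ fun j hj => (hint i hi j hj).const_mul _]
    simp only [integral_const_mul]
    refine Finset.sum_eq_single i (fun j hj hji => ?_) (fun h => absurd hi h)
    rw [horth i hi j hj hji.symm, mul_zero]
  have hI2 : (∫ y, ‖∑ i ∈ s, a i * f i y‖ ^ 2 : ℝ) =
      ∑ i ∈ s, ‖a i‖ ^ 2 * ∫ y, ‖f i y‖ ^ 2 := by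
    simp only [Complex.mul_conj'] at hI
    exact_mod_cast hI
  rw [← ofReal_integral_eq_lintegral_ofReal, hI2]
  · refine ENNReal.ofReal_le_ofReal (Finset.sum_le_sum fun i hi => ?_)
    gcongr
    refine (integral_mono_of_nonneg (ae_of_all _ fun y => sq_nonneg _)
      (integrable_const (B i ^ 2)) (ae_of_all _ fun y => ?_)).trans (by simp)
    exact pow_le_pow_left₀ (norm_nonneg _) (hB i hi y) 2
  · have : Integrable fun y => ((‖∑ i ∈ s, a i * f i y‖ ^ 2 : ℝ) : ℂ) := by
      simp only [hexp]
      exact integrable_finsetSum _ fun i hi => integrable_finsetSum _ fun j hj =>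
        (hint i hi j hj).const_mul _
    exact this.re.congr (ae_of_all _ fun y => Complex.ofReal_re _)
  · exact ae_of_all _ fun y => sq_nonneg _

/-- Bessel's inequality for absolutely convergent Fourier series. -/
lemma lintegral_norm_tsum_sq_le {d : ℤ → ℂ} {f : UnitAddCircle → ℂ}
    (hf : ∀ y, HasSum (fun l => d l * fourier (-l) y) (f y)) :
    ∫⁻ y, ENNReal.ofReal (‖f y‖ ^ 2) ≤ ∑' l, ENNReal.ofReal (‖d l‖ ^ 2) := by
  have hlim : ∀ y, Tendsto (fun s : Finset ℤ =>
      ENNReal.ofReal (‖∑ l ∈ s, d l * fourier (-l) y‖ ^ 2)) atTop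
      (𝓝 (ENNReal.ofReal (‖f y‖ ^ 2))) := fun y =>
    ENNReal.tendsto_ofReal ((hf y).norm.pow 2)
  -- Fatou's lemma along finite partial sums suffices, as only the inequality is needed.
  calc ∫⁻ y, ENNReal.ofReal (‖f y‖ ^ 2)
      = ∫⁻ y, liminf (fun s : Finset ℤ =>
          ENNReal.ofReal (‖∑ l ∈ s, d l * fourier (-l) y‖ ^ 2)) atTop :=
        lintegral_congr fun y => (hlim y).liminf_eq.symm
    _ ≤ liminf (fun s : Finset ℤ =>
          ∫⁻ y, ENNReal.ofReal (‖∑ l ∈ s, d l * fourier (-l) y‖ ^ 2)) atTop := by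
        refine lintegral_liminf_le fun s => ?_
        refine ENNReal.measurable_ofReal.comp (Continuous.measurable ?_)
        exact (continuous_finsetSum _ fun l _ =>
          continuous_const.mul (fourier (-l)).continuous).norm.pow 2
    _ ≤ ∑' l, ENNReal.ofReal (‖d l‖ ^ 2) := by
        refine liminf_le_of_le (h := fun b hb => ?_)
        obtain ⟨s, hs⟩ := hb.exists
        refine hs.trans ((lintegral_norm_sum_sq_le s d (fun l => fourier (-l)) (fun _ => 1)
          (fun l _ => (fourier (-l)).continuous.measurable)
          (fun l _ y => (norm_fourier_apply _ _).le)
          fun i _ j _ hij => integral_fourier_mul_conj hij).trans ?_)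
        rw [ENNReal.ofReal_sum_of_nonneg fun _ _ => by positivity]
        simp only [one_pow, mul_one]
        exact ENNReal.sum_le_tsum s

lemma lintegral_norm_sum_cellError_sq_le {n : ℕ} (hn : 1 ≤ n) (s : Finset ℤ)
    (hs : s ⊆ Finset.Ico (-(n : ℤ)) n) (a : ℤ → ℂ) :
    ∫⁻ y, ENNReal.ofReal (‖∑ k ∈ s, a k * cellError n k y‖ ^ 2) ≤
      ENNReal.ofReal (∑ k ∈ s, ‖a k‖ ^ 2 * (Real.pi * |(k : ℝ)| / n) ^ 2) :=
  lintegral_norm_sum_sq_le s a (cellError n) _ (fun k _ => measurable_cellError n k)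
    (fun k _ => norm_cellError_le hn k)
    fun _ hi _ hj hij => integral_cellError_mul_conj hn (hs hi) (hs hj) hij

end Torus

/-! ### Fourier decomposition of the error kernel -/

section ModeDecomposition

/-- The rate 16 is below `4π²` and is the one shared with the scheme. -/
lemma heatFactor_le (k : ℤ) {τ : ℝ} (hτ : 0 ≤ τ) :
    heatFactor k τ ≤ Real.exp (-(16 * k ^ 2 * τ)) := by
  apply Real.exp_le_exp.2
  have h1 : 16 ≤ 4 * Real.pi ^ 2 := by nlinarith [Real.pi_gt_three]
  have h2 : 0 ≤ (k : ℝ) ^ 2 * τ := by positivity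
  nlinarith

lemma heatFactor_pos (k : ℤ) (τ : ℝ) : 0 < heatFactor k τ := Real.exp_pos _

lemma summable_heatFactor {τ : ℝ} (hτ : 0 < τ) : Summable fun l : ℤ => heatFactor l τ := by
  have h : Summable fun l : ℤ => 1 / (16 * τ) * (1 / (l : ℝ) ^ 2) :=
    (Real.summable_one_div_int_pow.2 one_lt_two).mul_left _
  refine Summable.of_norm_bounded_eventually h ?_
  have : ∀ᶠ l : ℤ in cofinite, l ≠ 0 := (Set.finite_singleton (0 : ℤ)).compl_mem_cofinite
  filter_upwards [this] with l hl
  have hl' : (l : ℝ) ≠ 0 := by exact_mod_cast hl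
  rw [Real.norm_of_nonneg (heatFactor_pos l τ).le]
  refine (heatFactor_le l hτ.le).trans ?_
  have h1 := mul_exp_neg_le_one (16 * l ^ 2 * τ)
  have : 1 / (16 * τ) * (1 / (l : ℝ) ^ 2) = 1 / (16 * l ^ 2 * τ) := by field_simp
  rw [this, le_div_iff₀ (by positivity)]
  linarith

/-- The frequencies of `S` that are aliased to `l` on the grid `Π_M`. -/
def aliasSum (M : ℕ) (S : Finset ℤ) (b : ℤ → ℂ) (l : ℤ) : ℂ :=
  ∑ k ∈ S, b k * if (2 * M : ℤ) ∣ l - k then 1 else 0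

lemma fourier_sub_apply (k : ℤ) (x y : UnitAddCircle) :
    (fourier k (x - y) : ℂ) = fourier k x * fourier (-k) y := by
  rw [sub_eq_add_neg, fourier_add_apply, fourier_neg_apply]

/-- For `τ > 0` the kernel series converges absolutely, so the finite grid sums can be taken term by
term; each frequency then appears with the coefficients of the `k` it is aliased to. -/
lemma hasSum_discreteFourierCoeff_heatKernel {M : ℕ} (hM : 1 ≤ M) {τ : ℝ} (hτ : 0 < τ)
    (S : Finset ℤ) (b : ℤ → ℂ) (y : UnitAddCircle) :
    HasSum (fun l : ℤ => aliasSum M S b l * heatFactor l τ * fourier (-l) y)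
      (∑ k ∈ S, b k * discreteFourierCoeff M (fun i => heatKernel τ (gridPoint M i) y) k) := by
  have h1 : ∀ x : UnitAddCircle, HasSum (fun l : ℤ => (heatFactor l τ : ℂ) * fourier l (x - y))
      (heatKernel τ x y) := fun x => by
    refine Summable.hasSum (Summable.of_norm ?_)
    simp only [norm_mul, norm_fourier_apply, mul_one, Complex.norm_real]
    exact (summable_heatFactor hτ).norm
  have h2 : ∀ k, HasSum (fun l : ℤ => discreteFourierCoeff M
      (fun i => (heatFactor l τ : ℂ) * fourier l (gridPoint M i - y)) k)
      (discreteFourierCoeff M (fun i => heatKernel τ (gridPoint M i) y) k) := fun k =>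
    (hasSum_sum fun i _ => (h1 (gridPoint M i)).mul_right _).mul_left _
  have h3 := hasSum_sum (s := S) fun k _ => (h2 k).mul_left (b k)
  refine h3.congr_fun fun l => ?_
  have h4 : ∀ k, discreteFourierCoeff M
      (fun i => (heatFactor l τ : ℂ) * fourier l (gridPoint M i - y)) k =
      heatFactor l τ * fourier (-l) y * if (2 * M : ℤ) ∣ l - k then 1 else 0 := fun k => by
    rw [← discreteFourierCoeff_fourier hM l k]
    simp only [discreteFourierCoeff, restrictGrid, fourier_sub_apply, Finset.mul_sum]
    refine Finset.sum_congr rfl fun i _ => ?_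
    ring
  simp only [h4, aliasSum, Finset.sum_mul]
  refine Finset.sum_congr rfl fun k _ => ?_
  ring

lemma discreteFourierCoeff_discreteHeatKernel {c : ℝ} {n : ℕ} {k : ℤ}
    (hk : k ∈ Finset.Ico (-(n : ℤ)) n) (τ : ℝ) (y : UnitAddCircle) :
    discreteFourierCoeff n
      (fun i => discreteHeatKernel c n (kappa c n τ) (gridPoint n i) y) k =
      schemeFactor c n k τ * fourier (-k) y := by
  have h1 : (fun i => discreteHeatKernel c n (kappa c n τ) (gridPoint n i) y) = fun i =>
      ∑ j ∈ Finset.Ico (-(n : ℤ)) n, (schemeFactor c n j τ * fourier (-j) y : ℂ) *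
        restrictGrid n (fourier (T := (1 : ℝ)) j) i := by
    ext i
    refine Finset.sum_congr rfl fun j _ => ?_
    rw [fourier_sub_apply, restrictGrid, schemeFactor]
    ring
  rw [h1, discreteFourierCoeff_sum]
  rw [Finset.sum_eq_single k]
  · rw [discreteFourierCoeff_fourier_of_mem hk hk, if_pos rfl, mul_one]
  · intro j hj hjk
    rw [discreteFourierCoeff_fourier_of_mem hj hk, if_neg hjk, mul_zero]
  · exact fun h => absurd hk h

/-- The weight of the frequency `l` in the error of the mode `k`. -/
def modeWeight (n M : ℕ) (k l : ℤ) : ℝ :=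
  if l = k then (if k ∈ Finset.Ico (-(n : ℤ)) n then 20080 * (k ^ 2 / n ^ 2) else 2)
  else if (2 * M : ℤ) ∣ l - k then 2 else 0

lemma modeWeight_nonneg (n M : ℕ) (k l : ℤ) : 0 ≤ modeWeight n M k l := by
  unfold modeWeight
  split_ifs <;> positivity

/-- The amplitude of the frequency `l` in the smooth part of the error. -/
def smoothAmplitude (c : ℝ) (n M : ℕ) (S : Finset ℤ) (b : ℤ → ℂ) (τ : ℝ) (l : ℤ) : ℂ :=
  aliasSum M S b l * heatFactor l τ -
    if l ∈ S ∩ Finset.Ico (-(n : ℤ)) n then b l * schemeFactor c n l τ else 0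

/-- The integrand of the Wiener integral representing the error of the modes in `S`. -/
def errorKernel (c : ℝ) (n M : ℕ) (S : Finset ℤ) (b : ℤ → ℂ) (τ : ℝ) (y : UnitAddCircle) : ℂ :=
  ∑ k ∈ S, b k * (discreteFourierCoeff M (fun i => heatKernel τ (gridPoint M i) y) k -
    if k ∈ Finset.Ico (-(n : ℤ)) n then discreteFourierCoeff n
      (fun i => discreteHeatKernel c n (kappa c n τ) (gridPoint n i) (rho n y)) k else 0)

/-- Writing `e_{-k}(ρ_n(y))` as `e_{-k}(y)` minus the cell error leaves a pure Fourier series, where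
heat and scheme multipliers are compared at the same frequency, and a remainder made of cell errors.
-/
lemma errorKernel_eq {c : ℝ} {n M : ℕ} (hM : 1 ≤ M) {S : Finset ℤ} {b : ℤ → ℂ} {τ : ℝ}
    (hτ : 0 < τ) : ∃ f : UnitAddCircle → ℂ,
      (∀ y, HasSum (fun l => smoothAmplitude c n M S b τ l * fourier (-l) y) (f y)) ∧
      ∀ y, errorKernel c n M S b τ y = f y +
        ∑ k ∈ S ∩ Finset.Ico (-(n : ℤ)) n, b k * schemeFactor c n k τ * cellError n k y := by
  refine ⟨fun y => (∑ k ∈ S, b k *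
        discreteFourierCoeff M (fun i => heatKernel τ (gridPoint M i) y) k) -
      ∑ k ∈ S ∩ Finset.Ico (-(n : ℤ)) n, b k * schemeFactor c n k τ * fourier (-k) y,
    fun y => ?_, fun y => ?_⟩
  · have h1 := hasSum_discreteFourierCoeff_heatKernel hM hτ S b y
    have h2 : HasSum (fun l : ℤ => (if l ∈ S ∩ Finset.Ico (-(n : ℤ)) n
        then b l * schemeFactor c n l τ else 0) * (fourier (-l) y : ℂ))
        (∑ k ∈ S ∩ Finset.Ico (-(n : ℤ)) n, b k * schemeFactor c n k τ * fourier (-k) y) := by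
      have h3 : HasSum (fun l : ℤ => (if l ∈ S ∩ Finset.Ico (-(n : ℤ)) n
          then b l * schemeFactor c n l τ else 0) * (fourier (-l) y : ℂ))
          (∑ k ∈ S ∩ Finset.Ico (-(n : ℤ)) n, (if k ∈ S ∩ Finset.Ico (-(n : ℤ)) n
          then b k * schemeFactor c n k τ else 0) * (fourier (-k) y : ℂ)) :=
        hasSum_sum_of_ne_finset_zero fun l hl => by rw [if_neg hl, zero_mul]
      rwa [Finset.sum_congr rfl fun k hk => by rw [if_pos hk]] at h3
    refine (h1.sub h2).congr_fun fun l => ?_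
    rw [smoothAmplitude, sub_mul]
  · have h4 : ∑ k ∈ S ∩ Finset.Ico (-(n : ℤ)) n, b k * discreteFourierCoeff n
        (fun i => discreteHeatKernel c n (kappa c n τ) (gridPoint n i) (rho n y)) k =
        ∑ k ∈ S ∩ Finset.Ico (-(n : ℤ)) n,
          b k * schemeFactor c n k τ * fourier (-k) (rho n y) :=
      Finset.sum_congr rfl fun k hk => by
        rw [discreteFourierCoeff_discreteHeatKernel (Finset.mem_inter.1 hk).2, mul_assoc]
    simp only [errorKernel, mul_sub, Finset.sum_sub_distrib, cellError, mul_ite, mul_zero,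
      ← Finset.sum_filter, Finset.filter_mem_eq_inter, h4]
    ring

/-- Since `S` lies in `[-M, M)`, a frequency `l` is aliased to at most one `k ∈ S`. Hence no cross
terms in `k` arise, and one summand on the right dominates the left side. -/
lemma norm_smoothAmplitude_sq_le {c : ℝ} (hc : c ∈ Ioc (0 : ℝ) (1 / 8)) {n M : ℕ} (hn : 1 ≤ n)
    {S : Finset ℤ} (hS : S ⊆ Finset.Ico (-(M : ℤ)) M) (b : ℤ → ℂ) {τ : ℝ} (hτ : 0 ≤ τ) (l : ℤ) :
    2 * ‖smoothAmplitude c n M S b τ l‖ ^ 2 +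
      (if l ∈ S ∩ Finset.Ico (-(n : ℤ)) n then
        2 * (‖b l * schemeFactor c n l τ‖ ^ 2 * (Real.pi * |(l : ℝ)| / n) ^ 2) else 0) ≤
      ∑ k ∈ S, ‖b k‖ ^ 2 * (modeWeight n M k l * Real.exp (-(16 * l ^ 2 * τ))) := by
  have hn' : (0 : ℝ) < n := by exact_mod_cast hn
  have hnonneg : ∀ k ∈ S,
      0 ≤ ‖b k‖ ^ 2 * (modeWeight n M k l * Real.exp (-(16 * l ^ 2 * τ))) := fun k _ =>
    mul_nonneg (sq_nonneg _) (mul_nonneg (modeWeight_nonneg _ _ _ _) (Real.exp_pos _).le)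
  have hheat : heatFactor l τ ^ 2 ≤ Real.exp (-(16 * l ^ 2 * τ)) := by
    have h1 : Real.exp (-(16 * l ^ 2 * τ)) ≤ 1 := Real.exp_le_one_iff.2 (by
      have : 0 ≤ 16 * (l : ℝ) ^ 2 * τ := by positivity
      linarith)
    have h2 := heatFactor_le l hτ
    have h3 := heatFactor_pos l τ
    nlinarith
  by_cases hex : ∃ k ∈ S, (2 * M : ℤ) ∣ l - k
  swap
  · have hl : l ∉ S := fun hl => hex ⟨l, hl, by simp⟩
    have h0 : aliasSum M S b l = 0 := Finset.sum_eq_zero fun k hk => by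
      rw [if_neg fun h => hex ⟨k, hk, h⟩, mul_zero]
    have hl' : l ∉ S ∩ Finset.Ico (-(n : ℤ)) n := fun h => hl (Finset.mem_inter.1 h).1
    rw [smoothAmplitude, h0, if_neg hl', if_neg hl']
    simpa using Finset.sum_nonneg hnonneg
  obtain ⟨k, hk, hdvd⟩ := hex
  refine le_trans ?_ (Finset.single_le_sum hnonneg hk)
  have halias : aliasSum M S b l = b k := by
    rw [aliasSum, Finset.sum_eq_single k]
    · rw [if_pos hdvd, mul_one]
    · intro j hj hjk
      rw [if_neg, mul_zero]
      intro h
      have h2 := dvd_sub h hdvd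
      rw [sub_sub_sub_cancel_left] at h2
      exact hjk ((int_dvd_sub_iff (hS hk) (hS hj)).1 h2).symm
    · exact fun h => absurd hk h
  have hnormheat : ‖b k * heatFactor l τ‖ ^ 2 = ‖b k‖ ^ 2 * heatFactor l τ ^ 2 := by
    rw [norm_mul, Complex.norm_real, Real.norm_eq_abs, mul_pow, sq_abs]
  by_cases hlk : l = k
  · subst hlk
    rw [modeWeight, if_pos rfl, smoothAmplitude, halias]
    by_cases hmem : l ∈ Finset.Ico (-(n : ℤ)) n
    · have hl' : l ∈ S ∩ Finset.Ico (-(n : ℤ)) n := Finset.mem_inter.2 ⟨hk, hmem⟩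
      have hIcc : l ∈ Finset.Icc (-(n : ℤ)) n := Finset.Ico_subset_Icc_self hmem
      rw [if_pos hl', if_pos hl', if_pos hmem, ← mul_sub, norm_mul, norm_mul,
        ← Complex.ofReal_sub, Complex.norm_real, Complex.norm_real, Real.norm_eq_abs,
        Real.norm_of_nonneg (schemeFactor_nonneg hc hn)]
      have h1 := abs_heatFactor_sub_schemeFactor_le hc hn hIcc hτ
      have h2 := schemeFactor_le hc hn hIcc hτ
      have h3 := sq_le_of_mem_Icc hIcc
      set F := Real.exp (-(8 * l ^ 2 * τ)) with hF
      have hE : Real.exp (-(16 * l ^ 2 * τ)) = F * F := by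
        rw [hF, ← Real.exp_add]
        congr 1
        ring
      have hF1 : F ≤ 1 := Real.exp_le_one_iff.2 (by
        have : 0 ≤ 8 * (l : ℝ) ^ 2 * τ := by positivity
        linarith)
      have hF0 : 0 < F := Real.exp_pos _
      rw [hE] at h2 ⊢
      have hr1 : (l ^ 2 / n ^ 2 : ℝ) ≤ 1 := by rwa [div_le_one (by positivity)]
      have hr0 : 0 ≤ (l ^ 2 / n ^ 2 : ℝ) := by positivity
      have e1 : |heatFactor l τ - schemeFactor c n l τ| ^ 2 ≤ 10000 * (l ^ 2 / n ^ 2) * (F * F) := by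
        refine (pow_le_pow_left₀ (abs_nonneg _) h1 2).trans ?_
        have : (100 * (l ^ 2 / n ^ 2) * F) ^ 2 =
          10000 * ((l ^ 2 / n ^ 2) * (l ^ 2 / n ^ 2)) * (F * F) := by ring
        rw [this]
        gcongr
        nlinarith
      have e2 : schemeFactor c n l τ ^ 2 ≤ 4 * (F * F) := by
        refine (pow_le_pow_left₀ (schemeFactor_nonneg hc hn) h2 2).trans ?_
        have : (2 * (F * F)) ^ 2 = 4 * (F * F) * (F * F) := by ring
        rw [this]
        have : F * F ≤ 1 := by nlinarith
        nlinarith [mul_pos hF0 hF0]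
      have e3 : (Real.pi * |(l : ℝ)| / n) ^ 2 ≤ 10 * (l ^ 2 / n ^ 2) := by
        rw [div_pow, mul_pow, sq_abs, mul_div_assoc]
        gcongr
        nlinarith [Real.pi_lt_d2, Real.pi_pos]
      -- The constant in `modeWeight` is `20080 = 2·10000 + 2·4·10`: the multiplier error plus the
      -- cell error, with `π² ≤ 10`.
      calc 2 * (‖b l‖ * |heatFactor l τ - schemeFactor c n l τ|) ^ 2 +
            2 * ((‖b l‖ * schemeFactor c n l τ) ^ 2 * (Real.pi * |(l : ℝ)| / n) ^ 2)
          = ‖b l‖ ^ 2 * (2 * |heatFactor l τ - schemeFactor c n l τ| ^ 2 +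
            2 * (schemeFactor c n l τ ^ 2 * (Real.pi * |(l : ℝ)| / n) ^ 2)) := by ring
        _ ≤ ‖b l‖ ^ 2 * (2 * (10000 * (l ^ 2 / n ^ 2) * (F * F)) +
            2 * (4 * (F * F) * (10 * (l ^ 2 / n ^ 2)))) := by gcongr
        _ = _ := by ring
    · have hl' : l ∉ S ∩ Finset.Ico (-(n : ℤ)) n := fun h => hmem (Finset.mem_inter.1 h).2
      rw [if_neg hl', if_neg hl', if_neg hmem, sub_zero, add_zero, hnormheat]
      nlinarith [mul_le_mul_of_nonneg_left hheat (sq_nonneg ‖b l‖)]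
  · have hl : l ∉ S := fun hl => hlk ((int_dvd_sub_iff (hS hl) (hS hk)).1 hdvd)
    have hl' : l ∉ S ∩ Finset.Ico (-(n : ℤ)) n := fun h => hl (Finset.mem_inter.1 h).1
    rw [modeWeight, if_neg hlk, if_pos hdvd, smoothAmplitude, halias, if_neg hl', if_neg hl',
      sub_zero, add_zero, hnormheat]
    nlinarith [mul_le_mul_of_nonneg_left hheat (sq_nonneg ‖b k‖)]

/-- Each of the two parts of the kernel is a sum of orthogonal functions; between the parts only
`|f+g|² ≤ 2|f|² + 2|g|²` is used. -/
lemma lintegral_errorKernel_sq_le {c : ℝ} (hc : c ∈ Ioc (0 : ℝ) (1 / 8)) {n M : ℕ} (hn : 1 ≤ n)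
    (hM : 1 ≤ M) {S : Finset ℤ} (hS : S ⊆ Finset.Ico (-(M : ℤ)) M) (b : ℤ → ℂ) {τ : ℝ}
    (hτ : 0 < τ) :
    ∫⁻ y, ENNReal.ofReal (‖errorKernel c n M S b τ y‖ ^ 2) ≤
      ∑' l : ℤ, ∑ k ∈ S, ENNReal.ofReal (‖b k‖ ^ 2) *
        ENNReal.ofReal (modeWeight n M k l * Real.exp (-(16 * l ^ 2 * τ))) := by
  obtain ⟨f, hf, hG⟩ := errorKernel_eq (c := c) (n := n) (S := S) (b := b) hM hτ
  set g : UnitAddCircle → ℂ := fun y =>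
    ∑ k ∈ S ∩ Finset.Ico (-(n : ℤ)) n, b k * schemeFactor c n k τ * cellError n k y with hg
  have hgm : Measurable g := Finset.measurable_fun_sum _ fun k _ =>
    (measurable_cellError n k).const_mul _
  have h1 : ∀ y, ENNReal.ofReal (‖errorKernel c n M S b τ y‖ ^ 2) ≤
      2 * ENNReal.ofReal (‖f y‖ ^ 2) + 2 * ENNReal.ofReal (‖g y‖ ^ 2) := by
    intro y
    rw [hG, ← ENNReal.ofReal_ofNat 2, ← ENNReal.ofReal_mul (by norm_num),
      ← ENNReal.ofReal_mul (by norm_num), ← ENNReal.ofReal_add (by positivity) (by positivity)]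
    refine ENNReal.ofReal_le_ofReal ?_
    refine (pow_le_pow_left₀ (norm_nonneg _) (norm_add_le _ _) 2).trans ?_
    nlinarith [sq_nonneg (‖f y‖ - ‖g y‖)]
  have h2 := lintegral_norm_tsum_sq_le hf
  have h3 := lintegral_norm_sum_cellError_sq_le hn (S ∩ Finset.Ico (-(n : ℤ)) n)
    Finset.inter_subset_right fun k => b k * schemeFactor c n k τ
  calc ∫⁻ y, ENNReal.ofReal (‖errorKernel c n M S b τ y‖ ^ 2)
      ≤ ∫⁻ y, (2 * ENNReal.ofReal (‖f y‖ ^ 2) + 2 * ENNReal.ofReal (‖g y‖ ^ 2)) :=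
        lintegral_mono h1
    _ = 2 * (∫⁻ y, ENNReal.ofReal (‖f y‖ ^ 2)) + 2 * ∫⁻ y, ENNReal.ofReal (‖g y‖ ^ 2) := by
        rw [lintegral_add_right _ (by fun_prop), lintegral_const_mul' _ _ (by simp),
          lintegral_const_mul' _ _ (by simp)]
    _ ≤ 2 * (∑' l, ENNReal.ofReal (‖smoothAmplitude c n M S b τ l‖ ^ 2)) +
        2 * ∑' l, ENNReal.ofReal (if l ∈ S ∩ Finset.Ico (-(n : ℤ)) n then
        (‖b l * schemeFactor c n l τ‖ ^ 2 * (Real.pi * |(l : ℝ)| / n) ^ 2) else 0) := by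
        gcongr
        refine h3.trans ?_
        rw [ENNReal.ofReal_sum_of_nonneg fun _ _ => by positivity]
        refine le_trans (Finset.sum_le_sum fun k hk => ?_)
          (ENNReal.sum_le_tsum (S ∩ Finset.Ico (-(n : ℤ)) n))
        rw [if_pos hk]
    _ ≤ _ := by
        rw [← ENNReal.tsum_mul_left, ← ENNReal.tsum_mul_left, ← ENNReal.tsum_add]
        refine ENNReal.tsum_le_tsum fun l => ?_
        have h5 := norm_smoothAmplitude_sq_le hc hn hS b hτ.le l
        have h6 : ∀ k ∈ S, ENNReal.ofReal (‖b k‖ ^ 2) *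
            ENNReal.ofReal (modeWeight n M k l * Real.exp (-(16 * l ^ 2 * τ))) =
            ENNReal.ofReal (‖b k‖ ^ 2 * (modeWeight n M k l * Real.exp (-(16 * l ^ 2 * τ)))) :=
          fun k _ => (ENNReal.ofReal_mul (sq_nonneg _)).symm
        rw [Finset.sum_congr rfl h6, ← ENNReal.ofReal_sum_of_nonneg fun k _ =>
          mul_nonneg (sq_nonneg _) (mul_nonneg (modeWeight_nonneg _ _ _ _) (Real.exp_pos _).le)]
        rw [← ENNReal.ofReal_ofNat 2, ← ENNReal.ofReal_mul (by norm_num),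
          ← ENNReal.ofReal_mul (by norm_num), ← ENNReal.ofReal_add (by positivity)
          (by split_ifs <;> positivity)]
        refine ENNReal.ofReal_le_ofReal (le_trans (le_of_eq ?_) h5)
        split_ifs <;> simp

end ModeDecomposition

/-! ### Time integration and the mean square error of the modes -/

section ModeError

/-- Extending the integral to `-∞` makes the bound uniform in `t`. -/
lemma lintegral_exp_neg_le {a : ℝ} (ha : 0 < a) (t : ℝ) :
    ∫⁻ s in Ioo 0 t, ENNReal.ofReal (Real.exp (-(a * (t - s)))) ≤ ENNReal.ofReal (1 / a) := by
  have h1 : ∀ s, Real.exp (-(a * (t - s))) = Real.exp (-(a * t)) * Real.exp (a * s) := fun s => by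
    rw [← Real.exp_add]
    congr 1
    ring
  simp only [h1]
  refine (lintegral_mono_set (Ioo_subset_Iio_self.trans Iio_subset_Iic_self)).trans ?_
  rw [← ofReal_integral_eq_lintegral_ofReal ((integrableOn_exp_mul_Iic ha t).const_mul _)
    (ae_of_all _ fun s => by positivity), integral_const_mul, integral_exp_mul_Iic ha]
  refine ENNReal.ofReal_le_ofReal (le_of_eq ?_)
  rw [← mul_div_assoc, ← Real.exp_add, neg_add_cancel, Real.exp_zero]

/-- The frequency 0 is not damped in time, so it must carry no error: the multiplier and cell errors
vanish there, and 0 is aliased to no other `k` in the range. -/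
lemma modeWeight_zero_right {n M : ℕ} (hn : 1 ≤ n) {k : ℤ} (hk : k ∈ Finset.Ico (-(M : ℤ)) M) :
    modeWeight n M k 0 = 0 := by
  unfold modeWeight
  by_cases h0 : 0 = k
  · subst h0
    rw [if_pos rfl, if_pos (by rw [Finset.mem_Ico]; omega)]
    simp
  · have : ¬ (2 * M : ℤ) ∣ 0 - k := fun h =>
      h0 ((int_dvd_sub_iff (by rw [Finset.mem_Ico] at *; omega) hk).1 h)
    rw [if_neg h0, if_neg this]

lemma lintegral_modeWeight_le {n M : ℕ} (hn : 1 ≤ n) {k : ℤ}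
    (hk : k ∈ Finset.Ico (-(M : ℤ)) M) (l : ℤ) (t : ℝ) :
    ∫⁻ s in Ioo 0 t, ENNReal.ofReal (modeWeight n M k l * Real.exp (-(16 * l ^ 2 * (t - s)))) ≤
      ENNReal.ofReal (modeWeight n M k l / (16 * l ^ 2)) := by
  by_cases hl : l = 0
  · subst hl
    simp [modeWeight_zero_right hn hk]
  have hl' : (l : ℝ) ≠ 0 := by exact_mod_cast hl
  simp only [ENNReal.ofReal_mul (modeWeight_nonneg n M k l)]
  rw [lintegral_const_mul' _ _ ENNReal.ofReal_ne_top, div_eq_mul_one_div,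
    ENNReal.ofReal_mul (modeWeight_nonneg n M k l)]
  gcongr
  exact lintegral_exp_neg_le (by positivity) t

/-- The constant in the mean square error of a single mode. -/
def modeConst : ℝ := 1255 + (∑' r : ℤ, 1 / (r : ℝ) ^ 2) / 8

lemma modeConst_pos : 0 < modeConst := by
  have : 0 ≤ ∑' r : ℤ, 1 / (r : ℝ) ^ 2 := tsum_nonneg fun r => by positivity
  unfold modeConst
  positivity

/-- Three contributions, each of order `max(n,|k|)⁻²`: a resolved mode gives `20080/16 = 1255` times
`1/n²`; an unresolved one gives `1/(8k²)`; the aliases `l = k + 2Mr` satisfy `|l| ≥ M|r|` and sum to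
a multiple of `1/M²`, where `M ≥ max(n,|k|)`. -/
lemma tsum_modeWeight_le {n M : ℕ} (hn : 1 ≤ n) (hnM : n ≤ M) {k : ℤ}
    (hk : k ∈ Finset.Ico (-(M : ℤ)) M) :
    ∑' l : ℤ, ENNReal.ofReal (modeWeight n M k l / (16 * l ^ 2)) ≤
      ENNReal.ofReal (modeConst / (max (n : ℝ) |(k : ℝ)|) ^ 2) := by
  have hn' : (0 : ℝ) < n := by exact_mod_cast hn
  have hnM' : (n : ℝ) ≤ M := by exact_mod_cast hnM
  have hM' : (0 : ℝ) < M := hn'.trans_le hnM'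
  have hkM : |(k : ℝ)| ≤ M := by
    rw [Finset.mem_Ico] at hk
    rw [abs_le]
    exact ⟨by exact_mod_cast hk.1, by exact_mod_cast hk.2.le⟩
  set m := max (n : ℝ) |(k : ℝ)| with hm
  have hm0 : 0 < m := lt_max_of_lt_left hn'
  have hmM : m ≤ M := max_le hnM' hkM
  set f : ℤ → ENNReal := fun l =>
    if l ≠ k ∧ (2 * M : ℤ) ∣ l - k then ENNReal.ofReal (2 / (16 * l ^ 2)) else 0 with hf
  set D : ℝ := 1255 / m ^ 2 with hD
  have hsplit : ∀ l, ENNReal.ofReal (modeWeight n M k l / (16 * l ^ 2)) ≤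
      (if l = k then ENNReal.ofReal D else 0) + f l := by
    intro l
    by_cases hlk : l = k
    · subst hlk
      rw [if_pos rfl]
      refine le_trans (ENNReal.ofReal_le_ofReal ?_) le_self_add
      rw [modeWeight, if_pos rfl]
      rcases eq_or_ne (l : ℝ) 0 with hl0 | hl0
      · rw [hl0]
        simp only [ne_eq, OfNat.ofNat_ne_zero, not_false_eq_true, zero_pow, mul_zero, div_zero]
        positivity
      split_ifs with hmem
      · have hmn : m = n := by
          refine max_eq_left ?_
          rw [Finset.mem_Ico] at hmem
          rw [abs_le]
          exact ⟨by exact_mod_cast hmem.1, by exact_mod_cast hmem.2.le⟩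
        rw [hD, hmn]
        refine le_of_eq ?_
        field_simp
        norm_num
      · have hmk : m = |(l : ℝ)| := by
          refine max_eq_right ?_
          rw [Finset.mem_Ico] at hmem
          have : (n : ℤ) ≤ |l| := by
            rw [le_abs]
            omega
          exact_mod_cast this
        rw [hD, hmk, sq_abs, div_le_div_iff₀ (by positivity) (by positivity)]
        nlinarith [sq_nonneg (l : ℝ)]
    · rw [if_neg hlk, zero_add, hf, modeWeight, if_neg hlk]
      by_cases hd : (2 * M : ℤ) ∣ l - k
      · simp only [ne_eq, hlk, not_false_eq_true, hd, and_self, if_true, le_refl]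
      · simp [hd]
  have hinj : Function.Injective fun r : ℤ => k + 2 * M * r := fun r s hrs => by
    have h2 : (2 * M : ℤ) ≠ 0 := by
      have : 1 ≤ M := hn.trans hnM
      omega
    exact mul_left_cancel₀ h2 (add_left_cancel hrs)
  have hsupp : Function.support f ⊆ range fun r : ℤ => k + 2 * M * r := by
    intro l hl
    have : l ≠ k ∧ (2 * M : ℤ) ∣ l - k := by
      by_contra h
      exact hl (if_neg h)
    obtain ⟨r, hr⟩ := this.2
    exact ⟨r, by simp only; linarith⟩
  have hsum : Summable fun r : ℤ => 1 / (8 * (M : ℝ) ^ 2) * (1 / (r : ℝ) ^ 2) :=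
    (Real.summable_one_div_int_pow.2 one_lt_two).mul_left _
  have htail : ∑' l, f l ≤ ENNReal.ofReal ((∑' r : ℤ, 1 / (r : ℝ) ^ 2) / 8 / m ^ 2) := by
    rw [← hinj.tsum_eq hsupp]
    have hle : ∀ r : ℤ, f (k + 2 * M * r) ≤
        ENNReal.ofReal (1 / (8 * (M : ℝ) ^ 2) * (1 / (r : ℝ) ^ 2)) := by
      intro r
      -- At `r = 0` the alias is `k` itself, which `f` excludes; the right side is 0 there by the
      -- convention `1/0 = 0`.
      rcases eq_or_ne r 0 with rfl | hr
      · simp [hf]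
      simp only [hf]
      split_ifs
      · refine ENNReal.ofReal_le_ofReal ?_
        have hr1 : 1 ≤ |(r : ℝ)| := by exact_mod_cast Int.one_le_abs hr
        have habs : M * |(r : ℝ)| ≤ |((k + 2 * M * r : ℤ) : ℝ)| := by
          have h1 := abs_sub_abs_le_abs_add (2 * M * r : ℝ) k
          rw [abs_mul, abs_of_pos (by positivity : (0 : ℝ) < 2 * M), add_comm _ (k : ℝ)] at h1
          push_cast
          nlinarith
        have hsq := pow_le_pow_left₀ (by positivity) habs 2
        rw [mul_pow, sq_abs, sq_abs] at hsq
        have hr0 : (0 : ℝ) < r ^ 2 := by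
          have : (r : ℝ) ≠ 0 := by exact_mod_cast hr
          positivity
        calc 2 / (16 * ((k + 2 * M * r : ℤ) : ℝ) ^ 2) ≤ 2 / (16 * (M ^ 2 * r ^ 2)) := by gcongr
          _ = _ := by
            field_simp
            norm_num
      · exact zero_le
    refine (ENNReal.tsum_le_tsum hle).trans ?_
    rw [← ENNReal.ofReal_tsum_of_nonneg (fun r => by positivity) hsum, tsum_mul_left]
    refine ENNReal.ofReal_le_ofReal ?_
    have h0 : 0 ≤ ∑' r : ℤ, 1 / (r : ℝ) ^ 2 := tsum_nonneg fun r => by positivity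
    have h1 : 1 / (8 * (M : ℝ) ^ 2) ≤ 1 / (8 * m ^ 2) := by gcongr
    calc _ ≤ 1 / (8 * m ^ 2) * ∑' r : ℤ, 1 / (r : ℝ) ^ 2 := by gcongr
      _ = _ := by field_simp
  calc _ ≤ ∑' l, ((if l = k then ENNReal.ofReal D else 0) + f l) := ENNReal.tsum_le_tsum hsplit
    _ = ENNReal.ofReal D + ∑' l, f l := by rw [ENNReal.tsum_add, tsum_ite_eq]
    _ ≤ ENNReal.ofReal D + ENNReal.ofReal ((∑' r : ℤ, 1 / (r : ℝ) ^ 2) / 8 / m ^ 2) := by gcongr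
    _ = _ := by
      have h0 : 0 ≤ ∑' r : ℤ, 1 / (r : ℝ) ^ 2 := tsum_nonneg fun r => by positivity
      rw [← ENNReal.ofReal_add (by positivity) (by positivity), modeConst, hD, add_div]

variable {Ω : Type*} [MeasurableSpace Ω] {P : Measure Ω}
  {ξ : Set (ℝ × UnitAddCircle) → Ω → ℝ}

lemma IsWienerIntegral.discreteFourierCoeff {M : ℕ} {g : Fin (2 * M) → ℝ × UnitAddCircle → ℂ}
    {X : Fin (2 * M) → Ω → ℂ} (hξ : IsWhiteNoise P ξ) (h : ∀ i, IsWienerIntegral P ξ (g i) (X i))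
    (k : ℤ) : IsWienerIntegral P ξ (fun z => discreteFourierCoeff M (fun i => g i z) k)
      (fun ω => SpaceTimeNoise.discreteFourierCoeff M (fun i => X i ω) k) := by
  have := (IsWienerIntegral.sum hξ Finset.univ fun i _ => (h i).const_mul
    (starRingEnd ℂ (fourier k (gridPoint M i)))).const_mul (1 / (2 * M))
  simpa only [SpaceTimeNoise.discreteFourierCoeff, mul_comm] using this

lemma eLpNorm_two_le_of_lintegral_le {α : Type*} [MeasurableSpace α] {μ : Measure α} {f : α → ℂ}
    {B : ℝ} (hB : 0 ≤ B)
    (h : ∫⁻ z, ENNReal.ofReal (‖f z‖ ^ 2) ∂μ ≤ ENNReal.ofReal B) :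
    eLpNorm f 2 μ ≤ ENNReal.ofReal (√B) := by
  rw [eLpNorm_eq_lintegral_rpow_enorm_toReal (by simp) (by simp), Real.sqrt_eq_rpow,
    ← ENNReal.ofReal_rpow_of_nonneg hB (by norm_num)]
  simp only [ENNReal.toReal_ofNat]
  gcongr
  refine le_trans (le_of_eq (lintegral_congr fun z => ?_)) h
  rw [ENNReal.ofReal_pow (norm_nonneg _), ofReal_norm]
  norm_cast

/-- The moments of a linear combination of the Fourier modes of the error of the scheme. -/
theorem eLpNorm_modes_le [IsProbabilityMeasure P] (hξ : IsWhiteNoise P ξ) {c : ℝ}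
    (hc : c ∈ Ioc (0 : ℝ) (1 / 8)) {n M : ℕ} (hn : 1 ≤ n) (hnM : n ≤ M) {t : ℝ}
    {U : Fin (2 * M) → Ω → ℂ} {V : Fin (2 * n) → Ω → ℂ}
    (hU : ∀ i, IsWienerIntegral P ξ ((Ioo 0 t ×ˢ univ).indicator
      fun z => heatKernel (t - z.1) (gridPoint M i) z.2) (U i))
    (hV : ∀ i, IsWienerIntegral P ξ ((Ioo 0 t ×ˢ univ).indicator
      fun z => discreteHeatKernel c n (kappa c n (t - z.1)) (gridPoint n i) (rho n z.2)) (V i))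
    {S : Finset ℤ} (hS : S ⊆ Finset.Ico (-(M : ℤ)) M) (b : ℤ → ℂ) {p : ENNReal} (hp : 1 ≤ p)
    (hp' : p ≠ ⊤) :
    AEStronglyMeasurable (fun ω => ∑ k ∈ S, b k * (discreteFourierCoeff M (fun i => U i ω) k -
      if k ∈ Finset.Ico (-(n : ℤ)) n then discreteFourierCoeff n (fun i => V i ω) k else 0)) P ∧
    eLpNorm (fun ω => ∑ k ∈ S, b k * (discreteFourierCoeff M (fun i => U i ω) k -
      if k ∈ Finset.Ico (-(n : ℤ)) n then discreteFourierCoeff n (fun i => V i ω) k else 0)) p P ≤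
      2 * gaussianMoment p * ENNReal.ofReal
        (√(modeConst * ∑ k ∈ S, ‖b k‖ ^ 2 / (max (n : ℝ) |(k : ℝ)|) ^ 2)) := by
  have hM : 1 ≤ M := hn.trans hnM
  set G : ℝ × UnitAddCircle → ℂ := (Ioo 0 t ×ˢ univ).indicator
    fun z => errorKernel c n M S b (t - z.1) z.2 with hG
  have hW : IsWienerIntegral P ξ G
      (fun ω => ∑ k ∈ S, b k * (discreteFourierCoeff M (fun i => U i ω) k -
      if k ∈ Finset.Ico (-(n : ℤ)) n then discreteFourierCoeff n (fun i => V i ω) k else 0)) := by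
    have h1 : ∀ k ∈ S, IsWienerIntegral P ξ (fun z => b k * (discreteFourierCoeff M
        (fun i => (Ioo 0 t ×ˢ univ).indicator
          (fun z => heatKernel (t - z.1) (gridPoint M i) z.2) z) k -
        if k ∈ Finset.Ico (-(n : ℤ)) n then discreteFourierCoeff n (fun i =>
          (Ioo 0 t ×ˢ univ).indicator (fun z => discreteHeatKernel c n (kappa c n (t - z.1))
            (gridPoint n i) (rho n z.2)) z) k else 0))
        (fun ω => b k * (discreteFourierCoeff M (fun i => U i ω) k -
        if k ∈ Finset.Ico (-(n : ℤ)) n then discreteFourierCoeff n (fun i => V i ω) k else 0)) := by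
      intro k _
      refine IsWienerIntegral.const_mul ?_ (b k)
      by_cases hk : k ∈ Finset.Ico (-(n : ℤ)) n
      · simp only [if_pos hk]
        simpa only [neg_one_mul, ← sub_eq_add_neg] using (IsWienerIntegral.discreteFourierCoeff hξ hU k).add hξ
          ((IsWienerIntegral.discreteFourierCoeff hξ hV k).const_mul (-1))
      · simp only [if_neg hk, sub_zero]
        exact IsWienerIntegral.discreteFourierCoeff hξ hU k
    convert IsWienerIntegral.sum hξ S h1 using 1
    ext z
    by_cases hz : z ∈ Ioo 0 t ×ˢ (univ : Set UnitAddCircle)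
    · simp only [hG, indicator_of_mem hz, errorKernel]
    · simp [hG, indicator_of_notMem hz, SpaceTimeNoise.discreteFourierCoeff]
  refine ⟨hW.2.1.aestronglyMeasurable, (hW.eLpNorm_le hξ hp hp').trans ?_⟩
  gcongr
  have hnn : ∀ k ∈ S, 0 ≤ ‖b k‖ ^ 2 / (max (n : ℝ) |(k : ℝ)|) ^ 2 := fun k _ => by positivity
  refine eLpNorm_two_le_of_lintegral_le
    (mul_nonneg modeConst_pos.le (Finset.sum_nonneg hnn)) ?_
  have hbase : baseMeasure = (volume.restrict (Ici 0)).prod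
      (volume : Measure UnitAddCircle) := by
    rw [baseMeasure, Measure.volume_eq_prod, ← Measure.prod_restrict, Measure.restrict_univ]
  have hGm : AEMeasurable (fun z => ENNReal.ofReal (‖G z‖ ^ 2)) baseMeasure := by
    have := hW.1.aestronglyMeasurable
    exact ENNReal.measurable_ofReal.comp_aemeasurable (this.norm.aemeasurable.pow_const 2)
  rw [hbase] at hGm ⊢
  rw [lintegral_prod _ hGm]
  calc ∫⁻ s in Ici 0, ∫⁻ y, ENNReal.ofReal (‖G (s, y)‖ ^ 2)
      ≤ ∫⁻ s, ∫⁻ y, ENNReal.ofReal (‖G (s, y)‖ ^ 2) := setLIntegral_le_lintegral _ _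
    _ ≤ ∫⁻ s, (Ioo 0 t).indicator (fun s => ∑' l : ℤ, ∑ k ∈ S, ENNReal.ofReal (‖b k‖ ^ 2) *
        ENNReal.ofReal (modeWeight n M k l * Real.exp (-(16 * l ^ 2 * (t - s))))) s := by
        refine lintegral_mono fun s => ?_
        by_cases hs : s ∈ Ioo 0 t
        · rw [indicator_of_mem hs]
          -- The open interval matters: `s < t` gives `τ > 0`, where the heat kernel series
          -- converges absolutely.
          refine le_trans (le_of_eq ?_)
            (lintegral_errorKernel_sq_le hc hn hM hS b (sub_pos.2 hs.2))
          refine lintegral_congr fun y => ?_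
          rw [hG, indicator_of_mem (by exact ⟨hs, mem_univ _⟩)]
        · have : ∀ y, G (s, y) = 0 := fun y => indicator_of_notMem (fun h => hs h.1) _
          simp [this]
    _ = ∫⁻ s in Ioo 0 t, ∑' l : ℤ, ∑ k ∈ S, ENNReal.ofReal (‖b k‖ ^ 2) *
        ENNReal.ofReal (modeWeight n M k l * Real.exp (-(16 * l ^ 2 * (t - s)))) :=
        lintegral_indicator measurableSet_Ioo _
    _ = ∑' l : ℤ, ∑ k ∈ S, ENNReal.ofReal (‖b k‖ ^ 2) * ∫⁻ s in Ioo 0 t,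
        ENNReal.ofReal (modeWeight n M k l * Real.exp (-(16 * l ^ 2 * (t - s)))) := by
        rw [lintegral_tsum fun l => by fun_prop]
        congr 1 with l
        rw [lintegral_finsetSum _ fun k _ => by fun_prop]
        simp only [lintegral_const_mul' _ _ ENNReal.ofReal_ne_top]
    _ ≤ ∑' l : ℤ, ∑ k ∈ S, ENNReal.ofReal (‖b k‖ ^ 2) *
        ENNReal.ofReal (modeWeight n M k l / (16 * l ^ 2)) := by
        refine ENNReal.tsum_le_tsum fun l => Finset.sum_le_sum fun k hk => ?_
        gcongr
        exact lintegral_modeWeight_le hn (hS hk) l t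
    _ = ∑ k ∈ S, ENNReal.ofReal (‖b k‖ ^ 2) *
        ∑' l : ℤ, ENNReal.ofReal (modeWeight n M k l / (16 * l ^ 2)) := by
        rw [Summable.tsum_finsetSum fun _ _ => ENNReal.summable]
        simp only [ENNReal.tsum_mul_left]
    _ ≤ ∑ k ∈ S, ENNReal.ofReal (‖b k‖ ^ 2) *
        ENNReal.ofReal (modeConst / (max (n : ℝ) |(k : ℝ)|) ^ 2) := by
        refine Finset.sum_le_sum fun k hk => ?_
        gcongr
        exact tsum_modeWeight_le hn hnM (hS hk)
    _ = _ := by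
        rw [Finset.mul_sum, ENNReal.ofReal_sum_of_nonneg fun k hk =>
          mul_nonneg modeConst_pos.le (hnn k hk)]
        refine Finset.sum_congr rfl fun k _ => ?_
        rw [← ENNReal.ofReal_mul (sq_nonneg _)]
        congr 1
        ring

end ModeError

/-! ### Supports of the cutoffs and the size of a block -/

section Cutoff

variable {ε₀ : ℝ} {φ : ℝ → ℝ}

lemma IsBump.eq_zero (hφ : IsBump ε₀ φ) {x : ℝ} (hx : 1 < |x|) : φ x = 0 :=
  image_eq_zero_of_notMem_tsupport fun h => (abs_le.2 (hφ.support h)).not_gt hx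

lemma abs_cutoff_le_one (hφ : IsBump ε₀ φ) (ρ : ℝ) (j : ℕ) (x : ℝ) :
    |cutoff ε₀ φ ρ j x| ≤ 1 := by
  cases j with
  | zero =>
    have h := hφ.mem_Icc ((3 - 2 * ε₀) / 2 / ρ * x)
    exact abs_le.2 ⟨by linarith [h.1, show cutoff ε₀ φ ρ 0 x = φ ((3 - 2 * ε₀) / 2 / ρ * x) from rfl],
      h.2⟩
  | succ j =>
    have h1 := hφ.mem_Icc ((3 - 2 * ε₀) / 2 / ρ * (x / 2 ^ (j + 1)))
    have h2 := hφ.mem_Icc ((3 - 2 * ε₀) / 2 / ρ * (x / 2 ^ j))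
    simp only [cutoff, cutoffZero]
    rw [abs_le]
    constructor <;> linarith [h1.1, h1.2, h2.1, h2.2]

/-- These two bounds fix the support of all cutoffs uniformly in `ρ`: `7/10 · 2 > 1` gives the outer
radius `2·2^j`, and `3/2 · 3/5 = 9/10 ≤ 1 - ε₀` gives the inner radius `(3/10)2^j`. -/
lemma ratio_mem (hε₀ : ε₀ ∈ Ioo (0 : ℝ) (1 / 10)) {ρ : ℝ} (hρ : ρ ∈ Icc (1 : ℝ) 2) :
    (3 - 2 * ε₀) / 2 / ρ ∈ Ioc (7 / 10 : ℝ) (3 / 2) := by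
  obtain ⟨h1, h2⟩ := hε₀
  obtain ⟨h3, h4⟩ := hρ
  constructor
  · rw [lt_div_iff₀ (by linarith)]
    nlinarith
  · rw [div_le_iff₀ (by linarith)]
    nlinarith

lemma cutoff_eq_zero_of_lt (hε₀ : ε₀ ∈ Ioo (0 : ℝ) (1 / 10)) (hφ : IsBump ε₀ φ) {ρ : ℝ}
    (hρ : ρ ∈ Icc (1 : ℝ) 2) {j : ℕ} {x : ℝ} (hx : 2 * 2 ^ j < |x|) :
    cutoff ε₀ φ ρ j x = 0 := by
  obtain ⟨h1, -⟩ := ratio_mem hε₀ hρ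
  have key : ∀ i ≤ j, cutoffZero ε₀ φ ρ (x / 2 ^ i) = 0 := by
    intro i hi
    refine hφ.eq_zero ?_
    have hi2 : (2 : ℝ) ^ i ≤ 2 ^ j := pow_le_pow_right₀ one_le_two hi
    have h2 : 2 < |x / 2 ^ i| := by
      rw [abs_div, abs_of_pos (by positivity : (0 : ℝ) < 2 ^ i), lt_div_iff₀ (by positivity)]
      linarith
    rw [abs_mul, abs_of_pos (by linarith)]
    nlinarith
  cases j with
  | zero => simpa [cutoff] using key 0 le_rfl
  | succ j => rw [cutoff, key _ le_rfl, key _ (Nat.le_succ j), sub_zero]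

lemma cutoff_eq_zero_of_abs_lt (hε₀ : ε₀ ∈ Ioo (0 : ℝ) (1 / 10)) (hφ : IsBump ε₀ φ) {ρ : ℝ}
    (hρ : ρ ∈ Icc (1 : ℝ) 2) {j : ℕ} (hj : j ≠ 0) {x : ℝ} (hx : |x| < 3 / 10 * 2 ^ j) :
    cutoff ε₀ φ ρ j x = 0 := by
  obtain ⟨h1, h2⟩ := ratio_mem hε₀ hρ
  obtain ⟨j, rfl⟩ := Nat.exists_eq_succ_of_ne_zero hj
  have key : ∀ i, j ≤ i → cutoffZero ε₀ φ ρ (x / 2 ^ i) = 1 := by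
    intro i hi
    refine hφ.eq_one _ ?_
    have hi2 : (2 : ℝ) ^ j ≤ 2 ^ i := pow_le_pow_right₀ one_le_two hi
    have h3 : |x / 2 ^ i| ≤ 3 / 5 := by
      rw [abs_div, abs_of_pos (by positivity : (0 : ℝ) < 2 ^ i), div_le_iff₀ (by positivity)]
      rw [Nat.succ_eq_add_one, pow_succ] at hx
      linarith
    rw [abs_mul, abs_of_pos (by linarith)]
    nlinarith [hε₀.2, abs_nonneg (x / 2 ^ i)]
  rw [Nat.succ_eq_add_one, cutoff, key _ le_rfl, key _ (Nat.le_succ j), sub_self]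

lemma gridRatio_mem {n : ℕ} (hn : 1 ≤ n) : gridRatio n ∈ Icc (1 : ℝ) 2 := by
  have h1 : 2 ^ Nat.log 2 n ≤ n := Nat.pow_log_le_self 2 (by omega)
  have h2 : n < 2 ^ (Nat.log 2 n + 1) := Nat.lt_pow_succ_log_self (by norm_num) n
  unfold gridRatio
  constructor
  · rw [le_div_iff₀ (by positivity), one_mul]
    exact_mod_cast h1
  · rw [div_le_iff₀ (by positivity), mul_comm, ← pow_succ]
    exact_mod_cast h2.le

/-- On the support of the cutoff, `max(n,|k|)` dominates both `n` and `(3/10)2^j`, hence also their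
weighted geometric mean. There are at most `5·2^j` frequencies, and `5 · 100/9 ≤ 56`. -/
lemma sum_cutoff_sq_div_le (hε₀ : ε₀ ∈ Ioo (0 : ℝ) (1 / 10)) (hφ : IsBump ε₀ φ) {ρ : ℝ}
    (hρ : ρ ∈ Icc (1 : ℝ) 2) {n : ℕ} (hn : 1 ≤ n) {θ : ℝ} (hθ : θ ∈ Icc (0 : ℝ) 1) (j : ℕ)
    {S : Finset ℤ} (hS : S ⊆ Finset.Icc (-(2 * 2 ^ j : ℤ)) (2 * 2 ^ j)) {b : ℤ → ℂ}
    (hb : ∀ k, ‖b k‖ ≤ |cutoff ε₀ φ ρ j k|) :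
    ∑ k ∈ S, ‖b k‖ ^ 2 / (max (n : ℝ) |(k : ℝ)|) ^ 2 ≤
      56 * 2 ^ j / ((n : ℝ) ^ θ * ((2 : ℝ) ^ j) ^ (1 - θ)) ^ 2 := by
  have hn' : (1 : ℝ) ≤ n := by exact_mod_cast hn
  set X : ℝ := (n : ℝ) ^ θ * ((2 : ℝ) ^ j) ^ (1 - θ) with hX
  have hX0 : 0 < X := by positivity
  have hterm : ∀ k ∈ S, ‖b k‖ ^ 2 / (max (n : ℝ) |(k : ℝ)|) ^ 2 ≤ 100 / 9 / X ^ 2 := by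
    intro k _
    set m := max (n : ℝ) |(k : ℝ)| with hm
    have hmn : (n : ℝ) ≤ m := le_max_left _ _
    have hm0 : 0 < m := by linarith
    by_cases h0 : cutoff ε₀ φ ρ j k = 0
    · have : ‖b k‖ = 0 := le_antisymm (by simpa [h0] using hb k) (norm_nonneg _)
      rw [this]
      simp only [ne_eq, OfNat.ofNat_ne_zero, not_false_eq_true, zero_pow, zero_div]
      positivity
    have hj : 3 / 10 * 2 ^ j ≤ m := by
      -- The block `j = 0` has no inner hole, but there `3/10 ≤ 1 ≤ n`.
      rcases eq_or_ne j 0 with rfl | hj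
      · norm_num
        linarith
      · refine le_trans ?_ (le_max_right _ _)
        by_contra h
        exact h0 (cutoff_eq_zero_of_abs_lt hε₀ hφ hρ hj (not_le.1 h))
    have hmX : 3 / 10 * X ≤ m := by
      have e1 : (n : ℝ) ≤ 10 / 3 * m := by linarith
      have e2 : (2 : ℝ) ^ j ≤ 10 / 3 * m := by linarith
      have : X ≤ (10 / 3 * m) ^ θ * (10 / 3 * m) ^ (1 - θ) := by
        rw [hX]
        have := hθ.1
        have := sub_nonneg.2 hθ.2
        gcongr
      rw [← Real.rpow_add (by positivity), add_sub_cancel, Real.rpow_one] at this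
      linarith
    have hb1 : ‖b k‖ ^ 2 ≤ 1 := by
      have := (hb k).trans (abs_cutoff_le_one hφ ρ j k)
      exact pow_le_one₀ (norm_nonneg _) this
    have hsq := pow_le_pow_left₀ (by positivity) hmX 2
    calc ‖b k‖ ^ 2 / m ^ 2 ≤ 1 / (3 / 10 * X) ^ 2 := by gcongr
      _ = _ := by
        field_simp
        norm_num
  have hcard : (S.card : ℝ) ≤ 5 * 2 ^ j := by
    have h1 := Finset.card_le_card hS
    rw [Int.card_Icc] at h1
    have h2 : ((2 * 2 ^ j : ℤ) + 1 - -(2 * 2 ^ j)).toNat = 4 * 2 ^ j + 1 := by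
      have : (2 * 2 ^ j : ℤ) + 1 - -(2 * 2 ^ j) = ((4 * 2 ^ j + 1 : ℕ) : ℤ) := by
        push_cast
        ring
      rw [this, Int.toNat_natCast]
    rw [h2] at h1
    have h3 : (1 : ℝ) ≤ 2 ^ j := one_le_pow₀ one_le_two
    have h4 : (S.card : ℝ) ≤ 4 * 2 ^ j + 1 := by exact_mod_cast h1
    linarith
  refine (Finset.sum_le_card_nsmul _ _ _ hterm).trans ?_
  rw [nsmul_eq_mul]
  calc (S.card : ℝ) * (100 / 9 / X ^ 2) ≤ 5 * 2 ^ j * (100 / 9 / X ^ 2) := by gcongr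
    _ = 500 / 9 * 2 ^ j / X ^ 2 := by ring
    _ ≤ _ := by
      gcongr
      norm_num

/-- The size of the `j`-th Littlewood-Paley block of the error. -/
def blockSize (n : ℕ) (θ : ℝ) (j : ℕ) : ℝ :=
  √(56 * modeConst) * √(2 ^ j) / ((n : ℝ) ^ θ * ((2 : ℝ) ^ j) ^ (1 - θ))

lemma sqrt_sum_cutoff_le (hε₀ : ε₀ ∈ Ioo (0 : ℝ) (1 / 10)) (hφ : IsBump ε₀ φ) {ρ : ℝ}
    (hρ : ρ ∈ Icc (1 : ℝ) 2) {n : ℕ} (hn : 1 ≤ n) {θ : ℝ} (hθ : θ ∈ Icc (0 : ℝ) 1) (j : ℕ)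
    {S : Finset ℤ} (hS : S ⊆ Finset.Icc (-(2 * 2 ^ j : ℤ)) (2 * 2 ^ j)) {b : ℤ → ℂ}
    (hb : ∀ k, ‖b k‖ ≤ |cutoff ε₀ φ ρ j k|) :
    √(modeConst * ∑ k ∈ S, ‖b k‖ ^ 2 / (max (n : ℝ) |(k : ℝ)|) ^ 2) ≤ blockSize n θ j := by
  have h := mul_le_mul_of_nonneg_left (sum_cutoff_sq_div_le hε₀ hφ hρ hn hθ j hS hb)
    modeConst_pos.le
  refine (Real.sqrt_le_sqrt h).trans (le_of_eq ?_)
  rw [← mul_div_assoc, Real.sqrt_div' _ (sq_nonneg _), Real.sqrt_sq (by positivity), blockSize,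
    ← Real.sqrt_mul' _ (by positivity)]
  congr 2
  ring

end Cutoff

/-! ### From pointwise moments to the supremum over blocks and points -/

section Supremum

variable {Ω : Type*} [MeasurableSpace Ω] {P : Measure Ω}

/-- Jensen's inequality for the concave power `r ≤ 1`, obtained from monotonicity of `L^r` norms on
a probability space. -/
lemma lintegral_rpow_le_rpow_lintegral [IsProbabilityMeasure P] {W : Ω → ENNReal}
    (hW : AEMeasurable W P) {r : ℝ} (hr0 : 0 < r) (hr1 : r ≤ 1) :
    ∫⁻ ω, W ω ^ r ∂P ≤ (∫⁻ ω, W ω ∂P) ^ r := by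
  have h := eLpNorm'_le_eLpNorm'_of_exponent_le hr0 hr1 P hW.aestronglyMeasurable
  simp only [eLpNorm'_eq_lintegral_enorm, enorm_eq_self, ENNReal.rpow_one, div_one] at h
  have := ENNReal.rpow_le_rpow h hr0.le
  rwa [← ENNReal.rpow_mul, one_div, inv_mul_cancel₀ hr0.ne', ENNReal.rpow_one] at this

/-- Moments of a supremum over Littlewood-Paley blocks that are trigonometric polynomials. -/
theorem lintegral_iSup_rpow_le [IsProbabilityMeasure P] {p : ℕ} (hp : 1 ≤ p) {q : ℝ}
    (hq : 0 < q) (hqp : q ≤ p) (a R : ℕ → ℝ) (ha : ∀ j, 0 ≤ a j)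
    {Y : ℕ → UnitAddCircle → Ω → ℂ}
    (hm : ∀ j x, AEStronglyMeasurable (Y j x) P)
    (hY : ∀ j x, eLpNorm (Y j x) p P ≤ ENNReal.ofReal (R j)) {D : ℕ → ℕ}
    (hpoly : ∀ᵐ ω ∂P, ∀ j, ∃ f ∈ trigPoly (D j), ∀ x, f x = Y j x ω) {Z : Ω → ENNReal}
    (hZ : ∀ᵐ ω ∂P, Z ω ≤ ⨆ j, ENNReal.ofReal (a j) * ⨆ x, ‖Y j x ω‖ₑ) :
    ∫⁻ ω, Z ω ^ q ∂P ≤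
      (∑' j, ENNReal.ofReal ((a j) ^ p * ((2 * (p * D j + 1) : ℕ) * R j ^ p))) ^ (q / p) := by
  have hp' : (0 : ℝ) < p := by exact_mod_cast hp
  set W : Ω → ENNReal := fun ω => ∑' j, ∑ i : Fin (2 * (p * D j + 1)),
    ENNReal.ofReal (a j) ^ p * ‖Y j (gridPoint (p * D j + 1) i) ω‖ₑ ^ p with hW
  have hWm : AEMeasurable W P := AEMeasurable.tsum fun j =>
    Finset.aemeasurable_fun_sum _ fun i _ =>
      ((hm j _).enorm.pow_const p).const_mul _
  have hZW : ∀ᵐ ω ∂P, Z ω ^ q ≤ W ω ^ (q / p) := by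
    filter_upwards [hpoly, hZ] with ω hω hZω
    -- The supremum over `j` is bounded by an `ℓ^p` sum and that over `x` by the Nikolskii
    -- inequality; `p * D j + 1` is the least grid parameter it admits.
    have h1 : Z ω ≤ W ω ^ (1 / p : ℝ) := by
      refine hZω.trans (iSup_le fun j => ?_)
      rw [ENNReal.mul_iSup]
      refine iSup_le fun x => ?_
      obtain ⟨f, hf, hfY⟩ := hω j
      have h2 := norm_pow_le_sum_gridPoint (Nat.lt_succ_self (p * D j)) hf x
      have h3 : ‖Y j x ω‖ₑ ^ p ≤
          ∑ i, ‖Y j (gridPoint (p * D j + 1) i) ω‖ₑ ^ p := by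
        simp only [← hfY]
        simp only [← ofReal_norm, ← ENNReal.ofReal_pow (norm_nonneg _)]
        rw [← ENNReal.ofReal_sum_of_nonneg fun _ _ => by positivity]
        exact ENNReal.ofReal_le_ofReal h2
      have h4 : (ENNReal.ofReal (a j) * ‖Y j x ω‖ₑ) ^ p ≤ W ω := by
        rw [mul_pow]
        refine le_trans (mul_le_mul_right h3 _) ?_
        rw [Finset.mul_sum]
        exact ENNReal.le_tsum j
      have h5 := ENNReal.rpow_le_rpow h4 (by positivity : (0 : ℝ) ≤ 1 / p)
      rwa [← ENNReal.rpow_natCast, ← ENNReal.rpow_mul, mul_one_div_cancel hp'.ne',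
        ENNReal.rpow_one] at h5
    refine (ENNReal.rpow_le_rpow h1 hq.le).trans (le_of_eq ?_)
    rw [← ENNReal.rpow_mul]
    congr 1
    ring
  refine (lintegral_mono_ae hZW).trans
    ((lintegral_rpow_le_rpow_lintegral hWm (by positivity) ((div_le_one hp').2 hqp)).trans ?_)
  gcongr
  rw [hW, lintegral_tsum fun j => Finset.aemeasurable_fun_sum _ fun i _ =>
      ((hm j _).enorm.pow_const p).const_mul _]
  refine ENNReal.tsum_le_tsum fun j => ?_
  rw [lintegral_finsetSum' _ fun i _ => ((hm j _).enorm.pow_const p).const_mul _]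
  have hmom : ∀ x, ∫⁻ ω, ‖Y j x ω‖ₑ ^ p ∂P ≤ ENNReal.ofReal (R j) ^ p := fun x => by
    have h1 := pow_le_pow_left₀ zero_le (hY j x) p
    rw [eLpNorm_eq_lintegral_rpow_enorm_toReal (by simpa using by omega) (by simp),
      ← ENNReal.rpow_natCast, ← ENNReal.rpow_mul] at h1
    simpa [hp'.ne'] using h1
  calc ∑ i : Fin (2 * (p * D j + 1)), ∫⁻ ω, ENNReal.ofReal (a j) ^ p *
        ‖Y j (gridPoint (p * D j + 1) i) ω‖ₑ ^ p ∂P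
      ≤ ∑ i : Fin (2 * (p * D j + 1)), ENNReal.ofReal (a j) ^ p * ENNReal.ofReal (R j) ^ p := by
        refine Finset.sum_le_sum fun i _ => ?_
        rw [lintegral_const_mul' _ _ (by finiteness)]
        gcongr
        exact hmom _
    _ ≤ _ := by
        rw [Finset.sum_const, Finset.card_univ, Fintype.card_fin, nsmul_eq_mul]
        -- A negative `R j` is truncated to 0 by `ENNReal.ofReal`, so the left side vanishes because
        -- `p ≥ 1`.
        rcases le_or_gt 0 (R j) with hR | hR
        · rw [ENNReal.ofReal_mul (pow_nonneg (ha j) p), ENNReal.ofReal_mul (by positivity),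
            ENNReal.ofReal_natCast, ENNReal.ofReal_pow (ha j), ENNReal.ofReal_pow hR]
          exact le_of_eq (by ring)
        · rw [ENNReal.ofReal_of_nonpos hR.le, zero_pow (by omega), mul_zero, mul_zero]
          exact zero_le

end Supremum

/-! ### Summation over blocks and the two error bounds -/

section ErrorBounds

/-- The constant in the moment bound for a Littlewood-Paley block. -/
def blockConst (p : ℕ) : ℝ := 2 * (gaussianMoment p).toReal * √(56 * modeConst)

lemma blockConst_nonneg (p : ℕ) : 0 ≤ blockConst p := by
  unfold blockConst
  positivity

/-- The constant in the error bounds. -/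
def rateConst (p : ℕ) (q : ℝ) : ℝ := (12 * p * blockConst p ^ p) ^ (q / p) + 1

lemma rateConst_pos (p : ℕ) (q : ℝ) : 0 < rateConst p q := by
  have := blockConst_nonneg p
  unfold rateConst
  positivity

lemma two_mul_blockSize (p : ℕ) {n : ℕ} (hn : 1 ≤ n) (θ : ℝ) (j : ℕ) :
    2 * (gaussianMoment p).toReal * blockSize n θ j =
      blockConst p * (n : ℝ) ^ (-θ) * (2 : ℝ) ^ ((θ - 1 / 2) * j) := by
  have hn' : (0 : ℝ) < n := by exact_mod_cast hn
  have h1 : √((2 : ℝ) ^ j) = (2 : ℝ) ^ ((1 / 2 : ℝ) * j) := by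
    rw [Real.sqrt_eq_rpow, ← Real.rpow_natCast, ← Real.rpow_mul zero_le_two, mul_comm]
  have h2 : ((2 : ℝ) ^ j) ^ (1 - θ) = (2 : ℝ) ^ ((1 - θ) * j) := by
    rw [← Real.rpow_natCast, ← Real.rpow_mul zero_le_two, mul_comm]
  have h3 : (2 : ℝ) ^ ((θ - 1 / 2) * j) = (2 : ℝ) ^ ((1 / 2 : ℝ) * j) / 2 ^ ((1 - θ) * j) := by
    rw [← Real.rpow_sub zero_lt_two]
    congr 1
    ring
  rw [blockSize, h1, h2, h3, Real.rpow_neg hn'.le, blockConst]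
  field_simp

/-- Powers of `2^j`: `pα` from the Besov weight, `p(θ-1/2)` from the block moment and 1 from the
number of sampling points. In `hrate` the 2 pays for those points and for a geometric decay. -/
lemma block_term_le {p : ℕ} (hp : 1 ≤ p) {n : ℕ} (hn : 1 ≤ n) {α θ : ℝ}
    (hrate : p * (α + θ - 1 / 2) + 2 ≤ 0) (j : ℕ) :
    ((2 : ℝ) ^ (α * j)) ^ p * ((2 * (p * (2 * 2 ^ j) + 1) : ℕ) *
      (2 * (gaussianMoment p).toReal * blockSize n θ j) ^ p) ≤
      6 * p * blockConst p ^ p * (n : ℝ) ^ (-(θ * p)) * (1 / 2) ^ j := by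
  have hn' : (0 : ℝ) < n := by exact_mod_cast hn
  have hp' : (1 : ℝ) ≤ p := by exact_mod_cast hp
  have hB := blockConst_nonneg p
  have h1 : ((2 : ℝ) ^ (α * j)) ^ p = (2 : ℝ) ^ (α * j * p) := by
    rw [← Real.rpow_natCast, ← Real.rpow_mul zero_le_two]
  have h2 : ((2 : ℝ) ^ ((θ - 1 / 2) * j)) ^ p = (2 : ℝ) ^ ((θ - 1 / 2) * j * p) := by
    rw [← Real.rpow_natCast, ← Real.rpow_mul zero_le_two]
  have h3 : ((n : ℝ) ^ (-θ)) ^ p = (n : ℝ) ^ (-(θ * p)) := by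
    rw [← Real.rpow_natCast, ← Real.rpow_mul hn'.le, neg_mul]
  have h4 : ((2 * (p * (2 * 2 ^ j) + 1) : ℕ) : ℝ) ≤ 6 * p * (2 : ℝ) ^ (j : ℝ) := by
    rw [Real.rpow_natCast]
    push_cast
    have : (1 : ℝ) ≤ 2 ^ j := one_le_pow₀ one_le_two
    nlinarith
  have h5 : (2 : ℝ) ^ (α * j * p) * (2 : ℝ) ^ (j : ℝ) * (2 : ℝ) ^ ((θ - 1 / 2) * j * p) ≤
      (1 / 2) ^ j := by
    rw [← Real.rpow_add zero_lt_two, ← Real.rpow_add zero_lt_two]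
    have h6 : ((1 / 2 : ℝ)) ^ j = (2 : ℝ) ^ (-(j : ℝ)) := by
      rw [Real.rpow_neg zero_le_two, Real.rpow_natCast, one_div, inv_pow]
    rw [h6]
    refine Real.rpow_le_rpow_of_exponent_le one_le_two ?_
    have : (0 : ℝ) ≤ j := Nat.cast_nonneg j
    nlinarith
  rw [two_mul_blockSize p hn, mul_pow, mul_pow, h1, h2, h3]
  calc (2 : ℝ) ^ (α * j * p) * ((2 * (p * (2 * 2 ^ j) + 1) : ℕ) *
        (blockConst p ^ p * (n : ℝ) ^ (-(θ * p)) * (2 : ℝ) ^ ((θ - 1 / 2) * j * p)))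
      ≤ (2 : ℝ) ^ (α * j * p) * (6 * p * (2 : ℝ) ^ (j : ℝ) *
        (blockConst p ^ p * (n : ℝ) ^ (-(θ * p)) * (2 : ℝ) ^ ((θ - 1 / 2) * j * p))) := by
        gcongr
    _ = 6 * p * blockConst p ^ p * (n : ℝ) ^ (-(θ * p)) *
        ((2 : ℝ) ^ (α * j * p) * (2 : ℝ) ^ (j : ℝ) * (2 : ℝ) ^ ((θ - 1 / 2) * j * p)) := by ring
    _ ≤ _ := by gcongr

lemma tsum_block_le {p : ℕ} (hp : 1 ≤ p) {q : ℝ} (hq : 0 < q) {n : ℕ} (hn : 1 ≤ n) {α θ : ℝ}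
    (hrate : p * (α + θ - 1 / 2) + 2 ≤ 0) :
    (∑' j : ℕ, ENNReal.ofReal (((2 : ℝ) ^ (α * j)) ^ p * ((2 * (p * (2 * 2 ^ j) + 1) : ℕ) *
      (2 * (gaussianMoment p).toReal * blockSize n θ j) ^ p))) ^ (q / p) ≤
      ENNReal.ofReal (rateConst p q * (n : ℝ) ^ (-(q * θ))) := by
  have hn' : (0 : ℝ) < n := by exact_mod_cast hn
  have hp' : (0 : ℝ) < p := by exact_mod_cast hp
  have hB := blockConst_nonneg p
  set K : ℝ := 6 * p * blockConst p ^ p * (n : ℝ) ^ (-(θ * p)) with hK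
  have hK0 : 0 ≤ K := by positivity
  have h1 : ∑' j : ℕ, ENNReal.ofReal (((2 : ℝ) ^ (α * j)) ^ p *
      ((2 * (p * (2 * 2 ^ j) + 1) : ℕ) *
      (2 * (gaussianMoment p).toReal * blockSize n θ j) ^ p)) ≤ ENNReal.ofReal (K * 2) := by
    refine (ENNReal.tsum_le_tsum fun j =>
      ENNReal.ofReal_le_ofReal (block_term_le hp hn hrate j)).trans (le_of_eq ?_)
    rw [← ENNReal.ofReal_tsum_of_nonneg (fun j => by positivity)
      (summable_geometric_two.mul_left _), tsum_mul_left, tsum_geometric_two]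
  refine (ENNReal.rpow_le_rpow h1 (by positivity)).trans ?_
  rw [ENNReal.ofReal_rpow_of_nonneg (by positivity) (by positivity)]
  refine ENNReal.ofReal_le_ofReal ?_
  have h2 : K * 2 = 12 * p * blockConst p ^ p * (n : ℝ) ^ (-(θ * p)) := by
    rw [hK]
    ring
  rw [h2, Real.mul_rpow (by positivity) (by positivity), ← Real.rpow_mul hn'.le]
  have h3 : -(θ * p) * (q / p) = -(q * θ) := by field_simp
  rw [h3, rateConst]
  gcongr
  linarith

variable {Ω : Type*} [MeasurableSpace Ω] {P : Measure Ω}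
  {ξ : Set (ℝ × UnitAddCircle) → Ω → ℝ} {ε₀ : ℝ} {φ : ℝ → ℝ}

lemma norm_cutoff_mul_fourier (ρ : ℝ) (j : ℕ) (k : ℤ) (x : UnitAddCircle) :
    ‖(cutoff ε₀ φ ρ j k : ℂ) * fourier k x‖ = |cutoff ε₀ φ ρ j k| := by
  rw [norm_mul, norm_fourier_apply, mul_one, Complex.norm_real, Real.norm_eq_abs]

lemma exists_trigPoly_eq {D : ℕ} {S : Finset ℤ} (hS : S ⊆ Finset.Icc (-(D : ℤ)) D)
    (b a : ℤ → ℂ) : ∃ f ∈ trigPoly D, ∀ x, f x = ∑ k ∈ S, b k * fourier k x * a k := by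
  refine ⟨∑ k ∈ S, (b k * a k) • fourier k, Submodule.sum_mem _ fun k hk =>
    Submodule.smul_mem _ _ (fourier_mem_trigPoly ?_), fun x => ?_⟩
  · have := hS hk
    rwa [Finset.mem_Icc] at this
  · simp only [ContinuousMap.coe_sum, Finset.sum_apply, ContinuousMap.coe_smul, Pi.smul_apply,
      smul_eq_mul]
    exact Finset.sum_congr rfl fun k _ => by ring

lemma mul_ofReal_blockSize {p : ℕ} (n : ℕ) (θ : ℝ) (j : ℕ) :
    2 * gaussianMoment p * ENNReal.ofReal (blockSize n θ j) =
      ENNReal.ofReal (2 * (gaussianMoment p).toReal * blockSize n θ j) := by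
  rw [ENNReal.ofReal_mul (by positivity), ENNReal.ofReal_mul zero_le_two,
    ENNReal.ofReal_toReal (gaussianMoment_ne_top (by simp)), ENNReal.ofReal_ofNat]

/-- The error on the grid, in a discrete Besov norm. -/
theorem discreteError_le [IsProbabilityMeasure P] (hξ : IsWhiteNoise P ξ)
    (hε₀ : ε₀ ∈ Ioo (0 : ℝ) (1 / 10)) (hφ : IsBump ε₀ φ) {c : ℝ} (hc : c ∈ Ioc (0 : ℝ) (1 / 8))
    {n : ℕ} (hn : 1 ≤ n) {O : ℝ → UnitAddCircle → Ω → ℝ} {On : ℝ → Fin (2 * n) → Ω → ℝ}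
    (hO : IsLinearSolution P ξ O) (hOn : IsDiscreteLinearSolution P ξ c n On) {t : ℝ}
    (ht : 0 ≤ t) {p : ℕ} (hp : 1 ≤ p) {q : ℝ} (hq : 0 < q) (hqp : q ≤ p) {α θ : ℝ}
    (hθ : θ ∈ Icc (0 : ℝ) 1) (hrate : p * (α + θ - 1 / 2) + 2 ≤ 0) :
    discreteError P ε₀ φ α q n (O t) (On t) ≤
      ENNReal.ofReal (rateConst p q * (n : ℝ) ^ (-(q * θ))) := by
  refine le_trans ?_ (tsum_block_le hp hq hn hrate)
  set S : ℕ → Finset ℤ := fun j =>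
    Finset.Ico (-(n : ℤ)) n ∩ Finset.Icc (-(2 * 2 ^ j : ℤ)) (2 * 2 ^ j) with hS
  set A : Ω → ℤ → ℂ := fun ω k =>
    discreteFourierCoeff n (fun i => (O t (gridPoint n i) ω : ℂ)) k -
      if k ∈ Finset.Ico (-(n : ℤ)) n then discreteFourierCoeff n (fun i => (On t i ω : ℂ)) k
      else 0 with hA
  set Y : ℕ → UnitAddCircle → Ω → ℂ := fun j x ω =>
    ∑ k ∈ S j, (cutoff ε₀ φ (gridRatio n) j k : ℂ) * fourier k x * A ω k with hY
  -- Here `M = n`: the grid coefficients of `O_t` are used as they stand.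
  have key := fun (j : ℕ) (x : UnitAddCircle) => eLpNorm_modes_le hξ hc hn le_rfl
    (fun i => hO.integral t ht (gridPoint n i)) (fun i => hOn t ht i)
    (S := S j) Finset.inter_subset_left
    (fun k => (cutoff ε₀ φ (gridRatio n) j k : ℂ) * fourier k x) (p := p)
    (by exact_mod_cast hp) (by simp)
  refine lintegral_iSup_rpow_le hp hq hqp (fun j : ℕ => (2 : ℝ) ^ (α * j)) _
    (fun j => by positivity) (Y := Y) (D := fun j => 2 * 2 ^ j) (fun j x => (key j x).1)
    (fun j x => ?_) (ae_of_all _ fun ω j => exists_trigPoly_eq (S := S j) ?_ _ _)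
    (ae_of_all _ fun ω => ?_)
  · refine (key j x).2.trans ?_
    rw [← mul_ofReal_blockSize]
    gcongr
    exact sqrt_sum_cutoff_le hε₀ hφ (gridRatio_mem hn) hn hθ j Finset.inter_subset_right
      fun k => (norm_cutoff_mul_fourier _ j k x).le
  · push_cast
    exact Finset.inter_subset_right
  · refine iSup_mono fun j => ?_
    gcongr
    refine iSup_le fun i => ?_
    -- The discrete block is the restriction to the grid of a trigonometric polynomial, so its
    -- maximum is at most the supremum over the torus.
    refine le_trans (le_of_eq ?_) (le_iSup _ (gridPoint n i))
    congr 1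
    simp only [discreteBlock, hY]
    have hsub : S j ⊆ Finset.Ico (-(n : ℤ)) n := Finset.inter_subset_left
    rw [← Finset.sum_subset hsub]
    · refine Finset.sum_congr rfl fun k hk => ?_
      rw [hA]
      simp only [if_pos (hsub hk), restrictGrid, discreteFourierCoeff_sub]
      ring
    · intro k hk hkS
      have : (2 * 2 ^ j : ℝ) < |(k : ℝ)| := by
        have h1 : ¬ k ∈ Finset.Icc (-(2 * 2 ^ j : ℤ)) (2 * 2 ^ j) := fun h =>
          hkS (Finset.mem_inter.2 ⟨hk, h⟩)
        rw [Finset.mem_Icc, ← abs_le, not_le] at h1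
        exact_mod_cast h1
      rw [cutoff_eq_zero_of_lt hε₀ hφ (gridRatio_mem hn) this]
      simp

lemma fourierCoeff_sub_extendGrid {f : UnitAddCircle → ℂ} (hf : Continuous f) (n : ℕ)
    (g : Fin (2 * n) → ℂ) (k : ℤ) :
    fourierCoeff (fun x => f x - extendGrid n g x) k = fourierCoeff f k -
      if k ∈ Finset.Ico (-(n : ℤ)) n then discreteFourierCoeff n g k else 0 := by
  have hi : ∀ h : UnitAddCircle → ℂ, Continuous h →
      Integrable h AddCircle.haarAddCircle := fun h hh =>
    hh.integrable_of_hasCompactSupport (HasCompactSupport.of_compactSpace _)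
  have hterm : ∀ j : ℤ, Continuous fun x : UnitAddCircle =>
      discreteFourierCoeff n g j * (fourier j x : ℂ) := fun j =>
    continuous_const.mul (fourier j).continuous
  have hE : extendGrid n g = ∑ j ∈ Finset.Ico (-(n : ℤ)) n,
      fun x : UnitAddCircle => discreteFourierCoeff n g j * (fourier j x : ℂ) := by
    ext x
    simp [extendGrid]
  have hEc : Continuous (extendGrid n g) := continuous_finsetSum _ fun j _ => hterm j
  have h1 : fourierCoeff (fun x => f x - extendGrid n g x) k =
      fourierCoeff f k - fourierCoeff (extendGrid n g) k := by
    simp only [fourierCoeff, smul_sub]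
    exact integral_sub ((hi f hf).fourier_smul _) ((hi _ hEc).fourier_smul _)
  rw [h1, hE, fourierCoeff.sum _ _ fun j _ => hi _ (hterm j), Finset.sum_apply]
  simp only [fourierCoeff.const_mul, fourierCoeff_fourier, Pi.single_apply, mul_ite, mul_one,
    mul_zero, Finset.sum_ite_eq]

/-- The error of the interpolated scheme, in a Besov norm on the torus. -/
theorem continuousError_le [IsProbabilityMeasure P] (hξ : IsWhiteNoise P ξ)
    (hε₀ : ε₀ ∈ Ioo (0 : ℝ) (1 / 10)) (hφ : IsBump ε₀ φ) {c : ℝ} (hc : c ∈ Ioc (0 : ℝ) (1 / 8))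
    {n : ℕ} (hn : 1 ≤ n) {O : ℝ → UnitAddCircle → Ω → ℝ} {On : ℝ → Fin (2 * n) → Ω → ℝ}
    (hO : IsLinearSolution P ξ O) (hOn : IsDiscreteLinearSolution P ξ c n On) {t : ℝ}
    (ht : 0 ≤ t) {p : ℕ} (hp : 1 ≤ p) {q : ℝ} (hq : 0 < q) (hqp : q ≤ p) {α θ : ℝ}
    (hθ : θ ∈ Icc (0 : ℝ) 1) (hrate : p * (α + θ - 1 / 2) + 2 ≤ 0) :
    continuousError P ε₀ φ α q n (O t) (On t) ≤
      ENNReal.ofReal (rateConst p q * (n : ℝ) ^ (-(q * θ))) := by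
  refine le_trans ?_ (tsum_block_le hp hq hn hrate)
  have hone : (1 : ℝ) ∈ Icc (1 : ℝ) 2 := by norm_num
  have hcont : ∀ᵐ ω ∂P, Continuous fun x => O t x ω := by
    filter_upwards [hO.continuous] with ω hω
    refine continuousOn_univ.1 (hω.comp (f := fun x => (t, x)) (by fun_prop) fun x _ => ?_)
    exact ⟨ht, mem_univ _⟩
  set S : ℕ → Finset ℤ := fun j => Finset.Icc (-(2 * 2 ^ j : ℤ)) (2 * 2 ^ j) with hS
  set A : Ω → ℤ → ℂ := fun ω k => fourierCoeff (fun x => (O t x ω : ℂ)) k -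
    if k ∈ Finset.Ico (-(n : ℤ)) n then discreteFourierCoeff n (fun i => (On t i ω : ℂ)) k
      else 0 with hA
  set Y : ℕ → UnitAddCircle → Ω → ℂ := fun j x ω =>
    ∑ k ∈ S j, (cutoff ε₀ φ 1 j k : ℂ) * fourier k x * A ω k with hY
  -- The shift makes every sampling grid at least as fine as `Π_n` and fine enough to resolve the
  -- frequencies of the `j`-th block.
  set N : ℕ → ℕ → ℕ := fun j m => m + (n + 2 * 2 ^ j + 1) with hN
  set Ym : ℕ → ℕ → UnitAddCircle → Ω → ℂ := fun j m x ω =>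
    ∑ k ∈ S j, (cutoff ε₀ φ 1 j k : ℂ) * fourier k x *
      (discreteFourierCoeff (N j m) (fun i => (O t (gridPoint (N j m) i) ω : ℂ)) k -
        if k ∈ Finset.Ico (-(n : ℤ)) n then discreteFourierCoeff n (fun i => (On t i ω : ℂ)) k
        else 0) with hYm
  have hSN : ∀ j m, S j ⊆ Finset.Ico (-(N j m : ℤ)) (N j m) := by
    intro j m k hk
    rw [hS, Finset.mem_Icc] at hk
    rw [hN, Finset.mem_Ico]
    push_cast
    constructor <;> linarith [hk.1, hk.2]
  have key := fun (j m : ℕ) (x : UnitAddCircle) => eLpNorm_modes_le hξ hc hn (M := N j m) (by simp only [hN]; omega)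
    (fun i => hO.integral t ht (gridPoint (N j m) i)) (fun i => hOn t ht i)
    (hSN j m) (fun k => (cutoff ε₀ φ 1 j k : ℂ) * fourier k x) (p := p)
    (by exact_mod_cast hp) (by simp)
  have hlim : ∀ j x, ∀ᵐ ω ∂P, Tendsto (fun m => Ym j m x ω) atTop (𝓝 (Y j x ω)) := by
    intro j x
    filter_upwards [hcont] with ω hω
    refine tendsto_finsetSum _ fun k _ => tendsto_const_nhds.mul (Tendsto.sub ?_ tendsto_const_nhds)
    exact (tendsto_discreteFourierCoeff
      ⟨fun x => (O t x ω : ℂ), Complex.continuous_ofReal.comp hω⟩ k).comp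
      (tendsto_add_atTop_nat (n + 2 * 2 ^ j + 1))
  refine lintegral_iSup_rpow_le hp hq hqp (fun j : ℕ => (2 : ℝ) ^ (α * j)) _
    (fun j => by positivity) (Y := Y) (D := fun j => 2 * 2 ^ j)
    (fun j x => aestronglyMeasurable_of_tendsto_ae _ (fun m => (key j m x).1) (hlim j x))
    (fun j x => ?_) (ae_of_all _ fun ω j => exists_trigPoly_eq (S := S j) ?_ _ _) ?_
  -- The bound for the sampled modes does not depend on `m`, so Fatou's lemma passes it to the true
  -- Fourier coefficients.
  · refine (Lp.eLpNorm_lim_le_liminf_eLpNorm (fun m => (key j m x).1) _ (hlim j x)).trans ?_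
    refine liminf_le_of_le (h := fun b hb => ?_)
    obtain ⟨m, hm⟩ := hb.exists
    refine hm.trans ((key j m x).2.trans ?_)
    rw [← mul_ofReal_blockSize]
    gcongr
    exact sqrt_sum_cutoff_le hε₀ hφ hone hn hθ j subset_rfl
      fun k => (norm_cutoff_mul_fourier _ j k x).le
  · push_cast
    exact subset_rfl
  · filter_upwards [hcont] with ω hω
    refine iSup_mono fun j => ?_
    gcongr
    rw [eLpNorm_exponent_top]
    refine eLpNormEssSup_le_of_ae_enorm_bound (ae_of_all _ fun x => ?_)
    refine le_trans (le_of_eq ?_) (le_iSup _ x)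
    congr 1
    simp only [block, hY]
    rw [tsum_eq_sum (s := S j)]
    · refine Finset.sum_congr rfl fun k _ => ?_
      rw [fourierCoeff_sub_extendGrid (f := fun x => (O t x ω : ℂ))
        (Complex.continuous_ofReal.comp hω)]
      simp only [hA]
      ring
    · intro k hk
      have : (2 * 2 ^ j : ℝ) < |(k : ℝ)| := by
        rw [hS, Finset.mem_Icc, ← abs_le, not_le] at hk
        exact_mod_cast hk
      rw [cutoff_eq_zero_of_lt hε₀ hφ hone this]
      simp

end ErrorBounds

end SpaceTimeNoise

end

/-! ### Choice of the moment `p` and of the rate `θ` -/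

theorem mainTheorem3 (ε₀ : ℝ) (hε₀ : ε₀ ∈ Set.Ioo (0 : ℝ) (1 / 10)) (φ : ℝ → ℝ)
    (hφ : SpaceTimeNoise.IsBump ε₀ φ) (α q : ℝ) (hq : 1 ≤ q) :
    ∃ N : ℝ, 0 < N ∧
      ∀ (Ω : Type*) [MeasurableSpace Ω] (P : MeasureTheory.Measure Ω)
        [MeasureTheory.IsProbabilityMeasure P] (ξ : Set (ℝ × UnitAddCircle) → Ω → ℝ),
        SpaceTimeNoise.IsWhiteNoise P ξ →
      ∀ c ∈ Set.Ioc (0 : ℝ) (1 / 8), ∀ n : ℕ, 1 ≤ n →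
      ∀ (O : ℝ → UnitAddCircle → Ω → ℝ) (On : ℝ → Fin (2 * n) → Ω → ℝ),
        SpaceTimeNoise.IsLinearSolution P ξ O →
        SpaceTimeNoise.IsDiscreteLinearSolution P ξ c n On →
      ∀ t ∈ Set.Icc (0 : ℝ) 1,
        (α ∈ Set.Ioo (-1 / 2 : ℝ) (1 / 2) →
          SpaceTimeNoise.continuousError P ε₀ φ α q n (O t) (On t) ≤
              ENNReal.ofReal (N * (n : ℝ) ^ (-(q * (1 / 2 - α - 1 / q)))) ∧
          SpaceTimeNoise.discreteError P ε₀ φ α q n (O t) (On t) ≤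
              ENNReal.ofReal (N * (n : ℝ) ^ (-(q * (1 / 2 - α - 1 / q))))) ∧
        (α < -1 / 2 →
          SpaceTimeNoise.continuousError P ε₀ φ α q n (O t) (On t) ≤
              ENNReal.ofReal (N * (n : ℝ) ^ (-q)) ∧
          SpaceTimeNoise.discreteError P ε₀ φ α q n (O t) (On t) ≤
              ENNReal.ofReal (N * (n : ℝ) ^ (-q))) := by
  have hq0 : 0 < q := by linarith
  by_cases hA : α ∈ Set.Ioo (-1 / 2 : ℝ) (1 / 2)
  · have hα : 0 < 1 / 2 - α := by linarith [hA.2]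
    -- The term `2q` ensures `2/p ≤ 1/q`, so that `θ = 1/2-α-2/p` is at least the claimed rate. The
    -- other term ensures `θ ≥ 0`, while `α > -1/2` gives `θ ≤ 1`.
    obtain ⟨p, hp⟩ := exists_nat_ge (2 * q + 2 / (1 / 2 - α))
    have h0 : 0 < 2 / (1 / 2 - α) := by positivity
    have hp2q : 2 * q ≤ p := by linarith
    have hp0 : (0 : ℝ) < p := by linarith
    have hp1 : 1 ≤ p := by exact_mod_cast hp0
    have hpα : 2 ≤ p * (1 / 2 - α) := by
      rw [← div_le_iff₀ hα]
      linarith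
    have hθ : 1 / 2 - α - 2 / p ∈ Set.Icc (0 : ℝ) 1 := by
      have h1 : 2 / (p : ℝ) ≤ 1 / 2 - α := by
        rw [div_le_iff₀ hp0]
        linarith
      have h2 : 0 < 2 / (p : ℝ) := by positivity
      exact ⟨by linarith, by linarith [hA.1]⟩
    have hrate : p * (α + (1 / 2 - α - 2 / p) - 1 / 2) + 2 ≤ 0 := by
      have : (p : ℝ) * (α + (1 / 2 - α - 2 / p) - 1 / 2) = -2 := by
        field_simp
        ring
      linarith
    refine ⟨SpaceTimeNoise.rateConst p q, SpaceTimeNoise.rateConst_pos p q, ?_⟩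
    intro Ω _ P _ ξ hξ c hc n hn O On hO hOn t ht
    have hmono : ENNReal.ofReal (SpaceTimeNoise.rateConst p q *
        (n : ℝ) ^ (-(q * (1 / 2 - α - 2 / p)))) ≤ ENNReal.ofReal
        (SpaceTimeNoise.rateConst p q * (n : ℝ) ^ (-(q * (1 / 2 - α - 1 / q)))) := by
      refine ENNReal.ofReal_le_ofReal (mul_le_mul_of_nonneg_left ?_
        (SpaceTimeNoise.rateConst_pos p q).le)
      refine Real.rpow_le_rpow_of_exponent_le (by exact_mod_cast hn) ?_
      have h1 : q * (1 / q) = 1 := by field_simp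
      have h2 : q * (2 / p) ≤ 1 := by
        rw [← mul_div_assoc, div_le_one hp0]
        linarith
      nlinarith
    refine ⟨fun _ => ⟨?_, ?_⟩, fun h => absurd hA.1 (by linarith)⟩
    · exact (SpaceTimeNoise.continuousError_le hξ hε₀ hφ hc hn hO hOn ht.1 hp1 hq0
        (by linarith) hθ hrate).trans hmono
    · exact (SpaceTimeNoise.discreteError_le hξ hε₀ hφ hc hn hO hOn ht.1 hp1 hq0
        (by linarith) hθ hrate).trans hmono
  by_cases hB : α < -1 / 2
  · have hα : 0 < -1 / 2 - α := by linarith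
    -- For such rough norms the largest value `θ = 1` is admissible: the blocks are summable as soon
    -- as `p(-1/2-α) ≥ 2`.
    obtain ⟨p, hp⟩ := exists_nat_ge (q + 2 / (-1 / 2 - α))
    have h0 : 0 < 2 / (-1 / 2 - α) := by positivity
    have hp0 : (0 : ℝ) < p := by linarith
    have hp1 : 1 ≤ p := by exact_mod_cast hp0
    have hpα : 2 ≤ p * (-1 / 2 - α) := by
      rw [← div_le_iff₀ hα]
      linarith
    have hθ : (1 : ℝ) ∈ Set.Icc (0 : ℝ) 1 := ⟨zero_le_one, le_rfl⟩
    have hrate : p * (α + 1 - 1 / 2) + 2 ≤ 0 := by linarith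
    refine ⟨SpaceTimeNoise.rateConst p q, SpaceTimeNoise.rateConst_pos p q, ?_⟩
    intro Ω _ P _ ξ hξ c hc n hn O On hO hOn t ht
    refine ⟨fun h => absurd h hA, fun _ => ⟨?_, ?_⟩⟩
    · simpa only [mul_one] using SpaceTimeNoise.continuousError_le hξ hε₀ hφ hc hn hO hOn ht.1
        hp1 hq0 (by linarith) hθ hrate
    · simpa only [mul_one] using SpaceTimeNoise.discreteError_le hξ hε₀ hφ hc hn hO hOn ht.1
        hp1 hq0 (by linarith) hθ hrate
  -- For `α = -1/2` or `α ≥ 1/2` neither bound is asserted.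
  · exact ⟨1, one_pos, fun Ω _ P _ ξ _ c _ n _ O On _ _ t _ =>
      ⟨fun h => absurd h hA, fun h => absurd h hB⟩⟩
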